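/- In the abstract tile assembly model (aTAM), a tile system $\Gamma=(T,\sigma,\tau)$ consists of a finite set $T$ of non-rotatable unit square tile types with a glue on each edge (each glue having a non-negative integer strength), a seed assembly $\sigma$ and a positive integer temperature $\tau$. Assembly starts from $\sigma$ and proceeds by attaching one tile at a time so that each new assembly is $\tau$-stable, i.e. every cut of its bond graph has weight at least $\tau$. An assembly is terminal if it is producible in this way and no further tile can attach. A concentration distribution is a function $P:T\to(0,1]$ with $\sum_{t\in T}P(t)=1$. It turns assembly into a Markov chain in which an assembly $A$ passes to an assembly $B$, obtainable from $A$ by attaching one tile, of type $t_{A\to B}$, with probability $P(t_{A\to B})/\sum_{C}P(t_{A\to C})$, the sum being over all assemblies $C$ obtainable from $A$ by attaching one tile. Theorem. There are aTAM tile systems $\Gamma_n=(T_n,\sigma_n,\tau_n)$, $n=1,2,3,\dots$, with $|T_n|=O(\log n)$ as $n\to\infty$, such that for every $n\ge 1$ the following holds: $\tau_n=2$; the seed $\sigma_n$ is a single tile; every producible assembly can grow into a terminal assembly; every terminal assembly of $\Gamma_n$ is a width-4 line, i.e. its tiles fill exactly a rectangle of $4$ rows and $\ell$ columns, for some length $\ell$;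 and for every concentration distribution $P$ over $T_n$ the assembly process terminates with probability $1$ and the expected length of the terminal assembly, $$\sum_{A \text{ terminal}} \mathrm{length}(A)\cdot\Pr_P[\Gamma_n\to A],$$ is exactly $n$, where $\Pr_P[\Gamma_n\to A]$ is the probability that the chain ends in $A$. -/

import Mathlib

open scoped ENNReal NNReal
open scoped Classical
open Filter Asymptotics

noncomputable section

namespace ATAM

/-- The four edges of a unit square tile. -/
inductive Dir
  | north | east | south | west
  deriving DecidableEq

namespace Dir

instance : Fintype Dir where
  elems := {north, east, south, west}
  complete := by intro d; cases d <;> simp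

/-- The edge of the neighbouring tile that touches the edge `d`. -/
def opp : Dir → Dir
  | north => south
  | east => west
  | south => north
  | west => east

/-- The displacement to the neighbouring position across the edge `d`. -/
def vec : Dir → ℤ × ℤ
  | north => (0, 1)
  | east => (1, 0)
  | south => (0, -1)
  | west => (-1, 0)

end Dir

/-- A tile type over the glue alphabet `G`: a glue on each edge and a finite string label.
Tiles are translated but never rotated. -/
structure Tile (G : Type) where
  glue : Dir → G
  label : String

/-- An assembly: a set of tiles at distinct positions of `ℤ²`, as a partial function. -/
abbrev Assembly (G : Type) : Type := ℤ × ℤ → Option (Tile G)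

namespace Assembly

variable {G : Type}

/-- The set of occupied positions. -/
def dom (α : Assembly G) : Set (ℤ × ℤ) := {p | α p ≠ none}

/-- The assembly `α ∪ {b}`, where `b` is the translation of `t` to the position `p`. -/
def add (α : Assembly G) (p : ℤ × ℤ) (t : Tile G) : Assembly G :=
  Function.update α p (some t)

/-- The weight of the edge of the bond graph between the position `p` and its neighbour in
direction `d`: the strength of the shared glue if the two abutting glues agree, and `0`
otherwise (also if one of the two positions is empty). -/
def bond (str : G → ℕ) (α : Assembly G) (p : ℤ × ℤ) (d : Dir) : ℕ :=
  match α p, α (p + d.vec) with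
  | some a, some b => if a.glue d = b.glue d.opp then str (a.glue d) else 0
  | _, _ => 0

/-- The total weight of the edges of the bond graph that leave the set `S` of positions. -/
def cutWeight (str : G → ℕ) (α : Assembly G) (S : Finset (ℤ × ℤ)) : ℕ :=
  ∑ p ∈ S, ∑ d : Dir, if p + d.vec ∈ S then 0 else bond str α p d

/-- `τ`-stability of a (finite) assembly: every cut of the bond graph into two non-empty
parts has weight at least `τ`. -/
def Stable (str : G → ℕ) (τ : ℕ) (α : Assembly G) : Prop :=
  ∀ S : Finset (ℤ × ℤ), S.Nonempty → (S : Set (ℤ × ℤ)) ⊂ α.dom → τ ≤ cutWeight str α S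

/-- The assembly is a line of width `w` and length `l`: its tiles fill exactly a rectangle of
`l` columns and `w` rows. -/
def IsLine (w l : ℕ) (α : Assembly G) : Prop :=
  ∃ a b : ℤ, α.dom = Set.Ico a (a + l) ×ˢ Set.Ico b (b + w)

/-- The length of a linear assembly: the number of columns that it occupies. -/
def length (α : Assembly G) : ℕ := (Prod.fst '' α.dom).ncard

end Assembly

/-- A tile system `Γ = (T, σ, τ)`, together with its glue alphabet and glue strengths. -/
structure TileSystem where
  Glue : Type
  str : Glue → ℕ
  /-- the tile set `T` -/
  tiles : Finset (Tile Glue)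
  /-- the seed `σ` -/
  seed : Assembly Glue
  /-- the temperature `τ` -/
  temp : ℕ
  temp_pos : 0 < temp
  seed_finite : seed.dom.Finite
  seed_nonempty : seed.dom.Nonempty
  seed_tiles : ∀ p t, seed p = some t → t ∈ tiles
  seed_stable : seed.Stable str temp

namespace TileSystem

variable (Γ : TileSystem)

/-- `A` grows into `B` through a single attachment of a tile of type `t`. -/
def Attach (A : Assembly Γ.Glue) (t : Tile Γ.Glue) (B : Assembly Γ.Glue) : Prop :=
  t ∈ Γ.tiles ∧ ∃ p, A p = none ∧ B = A.add p t ∧ B.Stable Γ.str Γ.temp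

/-- `A →₁ B`: growth through a single tile attachment. -/
def Step (A B : Assembly Γ.Glue) : Prop := ∃ t, Γ.Attach A t B

/-- `A → B`: growth through zero or more tile attachments. -/
def Grows : Assembly Γ.Glue → Assembly Γ.Glue → Prop := Relation.ReflTransGen Γ.Step

/-- Producible assemblies. -/
def Producible (A : Assembly Γ.Glue) : Prop := Γ.Grows Γ.seed A

/-- Terminal assemblies: producible, and no further tile may attach. -/
def Terminal (A : Assembly Γ.Glue) : Prop := Γ.Producible A ∧ ∀ B, ¬ Γ.Step A B

/-- Every producible assembly can grow into a terminal assembly. -/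
def IsFinite : Prop := ∀ B, Γ.Producible B → ∃ A, Γ.Terminal A ∧ Γ.Grows B A

/-- Concentration distributions over the tile set (values off the tile set play no role). -/
def IsConcentration (P : Tile Γ.Glue → ℝ≥0) : Prop :=
  (∀ t ∈ Γ.tiles, 0 < P t) ∧ ∑ t ∈ Γ.tiles, P t = 1

/-- The concentration of the tile type whose attachment turns `A` into `B`, and `0` if `A →₁ B`
fails. (That tile type is unique, so at most one summand is non-zero.) -/
def weight (P : Tile Γ.Glue → ℝ≥0) (A B : Assembly Γ.Glue) : ℝ≥0∞ :=
  ∑ t ∈ Γ.tiles, if Γ.Attach A t B then (P t : ℝ≥0∞) else 0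

/-- The transition probability of the assembly process from `A` to `B`. -/
def trans (P : Tile Γ.Glue → ℝ≥0) (A B : Assembly Γ.Glue) : ℝ≥0∞ :=
  Γ.weight P A B / ∑' C, Γ.weight P A C

/-- The probability that the assembly process, started at the seed and stopped when no tile can
attach, makes at least `k` transitions and is in the state `A` after exactly `k` of them. -/
def probAt (P : Tile Γ.Glue → ℝ≥0) : ℕ → Assembly Γ.Glue → ℝ≥0∞
  | 0, A => if A = Γ.seed then 1 else 0
  | k + 1, B => ∑' A, probAt P k A * Γ.trans P A B

/-- The probability that the system terminally assembles the terminal assembly `A`: the process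
arrives in `A` after some number of transitions (and then stays there). -/
def probTerm (P : Tile Γ.Glue → ℝ≥0) (A : Assembly Γ.Glue) : ℝ≥0∞ :=
  ∑' k, Γ.probAt P k A

/-- The probability that the assembly process terminates. -/
def totalProb (P : Tile Γ.Glue → ℝ≥0) : ℝ≥0∞ :=
  ∑' A : {A : Assembly Γ.Glue // Γ.Terminal A}, Γ.probTerm P A.1

/-- The expected length of the terminal assembly. -/
def expectedLength (P : Tile Γ.Glue → ℝ≥0) : ℝ≥0∞ :=
  ∑' A : {A : Assembly Γ.Glue // Γ.Terminal A}, (A.1.length : ℝ≥0∞) * Γ.probTerm P A.1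

end TileSystem

end ATAM

end

/-! A line is a chain of rectangular blocks of four rows growing eastward. A column block has one
column and leads to the next lower state. A coin block has five columns and leads with probability
exactly 1/2 to the next lower state `i` and with probability 1/2 back to state `m`. If `E i` is the
expected number of columns still to come from state `i`, then `E (i+1) = 1 + E i` or `E (i+1) = 5 +
E m / 2 + E i / 2`. The gap `G i = E m - E i` therefore satisfies `G i = G (i+1) + 1` or `G i = 2 *
G (i+1) + 10`, with `G m = 0` and `G 0 = E m`. Repeated halving reaches every prescribed `E m` with
logarithmically many states (`exists_gaps`, `exists_isExpectation`), and each state needs at most 20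
tile types.

The coin must be fair for all concentrations. Let tiles 15 and 16 have concentrations `u` and `v`.
Tile 15 fits at (2,1), tile 16 at (3,0), and they compete for (3,1): tile 16 can enter it from a
tile 15 at (2,1), tile 15 from a tile 16 at (3,0). Exit 3 opens iff tile 16 wins (3,1). If tile 15
came first, the next race move places tile 16, at (3,0) or (3,1) with equal chances; in the former
case (3,1) is still contested and tile 16 wins it with probability `v/(u+v)`. The opposite case is
symmetric. Exit 3 thus has probability `u/(u+v) * (1/2 + 1/2 * v/(u+v)) + v/(u+v) * 1/2 * v/(u+v) =
1/2`. In the form of a harmonic identity this is `sum_moves_exit`.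

Several blocks may grow concurrently, so no order of attachments is imposed. Instead `mean`, the
width of all blocks but the easternmost plus the expected width from that block on, is harmonic for
the full chain (`sum_allMoves`). Since the number of tiles grows by one per step and is at most `4 *
mean`, the expected running time is finite, and optional stopping (`tsum_stopped`) gives both
termination and the expected length.

The link to the tile model is `stable_add_iff` (attachability is a matter of local binding
strength), the kernel-checked tables of the two blocks, and `two_le_binding_iff` with
`two_le_binding_outside`, which show that neighbouring blocks interact only through entrance and
exit. -/

noncomputable section

namespace ATAM

/-! ### Averaging operators of finitely branching Markov chains -/

section Avg

variable {S : Type*}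

/-- One step of the chain that moves along the weighted list `mv s`, as an operator on functions
of the state; states without moves are absorbing and contribute `0`. -/
def avg (mv : S → List (ℝ≥0∞ × S)) (φ : S → ℝ≥0∞) (s : S) : ℝ≥0∞ :=
  ((mv s).map fun m => m.1 * φ m.2).sum / ((mv s).map fun m => m.1).sum

variable {mv : S → List (ℝ≥0∞ × S)} {I : S → Prop}

theorem avg_add (φ ψ : S → ℝ≥0∞) : avg mv (φ + ψ) = avg mv φ + avg mv ψ := by
  funext s
  simp only [avg, Pi.add_apply, mul_add, List.sum_map_add, ENNReal.add_div]

theorem iterate_avg_add (k : ℕ) (φ ψ : S → ℝ≥0∞) :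
    (avg mv)^[k] (φ + ψ) = (avg mv)^[k] φ + (avg mv)^[k] ψ := by
  induction k generalizing φ ψ with
  | zero => rfl
  | succ k ih => simp only [Function.iterate_succ_apply, avg_add, ih]

theorem avg_smul (c : ℝ≥0∞) (φ : S → ℝ≥0∞) :
    avg mv (fun s => c * φ s) = fun s => c * avg mv φ s := by
  funext s
  simp only [avg, mul_left_comm _ c, List.sum_map_mul_left, mul_div_assoc]

theorem iterate_avg_smul (k : ℕ) (c : ℝ≥0∞) (φ : S → ℝ≥0∞) :
    (avg mv)^[k] (fun s => c * φ s) = fun s => c * (avg mv)^[k] φ s := by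
  induction k generalizing φ with
  | zero => rfl
  | succ k ih => simp only [Function.iterate_succ_apply, avg_smul, ih]

theorem list_sum_map_le {α : Type*} (l : List α) {f g : α → ℝ≥0∞} (h : ∀ a ∈ l, f a ≤ g a) :
    (l.map f).sum ≤ (l.map g).sum := by
  induction l with
  | nil => simp
  | cons a l ih =>
    simp only [List.map_cons, List.sum_cons]
    exact add_le_add (h a (by simp)) (ih fun b hb => h b (by simp [hb]))

theorem avg_mono (hI : ∀ s, I s → ∀ m ∈ mv s, I m.2) {φ ψ : S → ℝ≥0∞}
    (h : ∀ s, I s → φ s ≤ ψ s) : ∀ s, I s → avg mv φ s ≤ avg mv ψ s := by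
  intro s hs
  refine ENNReal.div_le_div_right (list_sum_map_le _ fun m hm => ?_) _
  gcongr
  exact h _ (hI s hs m hm)

theorem iterate_avg_mono (hI : ∀ s, I s → ∀ m ∈ mv s, I m.2) (k : ℕ) {φ ψ : S → ℝ≥0∞}
    (h : ∀ s, I s → φ s ≤ ψ s) : ∀ s, I s → (avg mv)^[k] φ s ≤ (avg mv)^[k] ψ s := by
  induction k generalizing φ ψ with
  | zero => exact h
  | succ k ih =>
    simp only [Function.iterate_succ_apply]
    exact ih (avg_mono hI h)

theorem iterate_avg_congr (hI : ∀ s, I s → ∀ m ∈ mv s, I m.2) (k : ℕ) {φ ψ : S → ℝ≥0∞}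
    (h : ∀ s, I s → φ s = ψ s) : ∀ s, I s → (avg mv)^[k] φ s = (avg mv)^[k] ψ s := fun s hs =>
  le_antisymm (iterate_avg_mono hI k (fun s hs => (h s hs).le) s hs)
    (iterate_avg_mono hI k (fun s hs => (h s hs).ge) s hs)

/-- The indicator function of the states without moves. -/
def stopped (mv : S → List (ℝ≥0∞ × S)) (s : S) : ℝ≥0∞ := if mv s = [] then 1 else 0

/-- The indicator function of the states with moves. -/
def running (mv : S → List (ℝ≥0∞ × S)) (s : S) : ℝ≥0∞ := if mv s = [] then 0 else 1

theorem avg_of_nil {s : S} (h : mv s = []) (φ : S → ℝ≥0∞) : avg mv φ s = 0 := by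
  simp [avg, h]

theorem list_sum_ne_zero {l : List (ℝ≥0∞ × S)} (hl : l ≠ []) (h : ∀ m ∈ l, m.1 ≠ 0) :
    (l.map fun m => m.1).sum ≠ 0 := by
  cases l with
  | nil => exact absurd rfl hl
  | cons a l =>
    simp only [List.map_cons, List.sum_cons]
    intro h0
    exact h a (by simp) (add_eq_zero.1 h0).1

theorem list_sum_ne_top {l : List (ℝ≥0∞ × S)} (h : ∀ m ∈ l, m.1 ≠ ⊤) :
    (l.map fun m => m.1).sum ≠ ⊤ := by
  induction l with
  | nil => simp
  | cons a l ih =>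
    simp only [List.map_cons, List.sum_cons]
    exact ENNReal.add_ne_top.2 ⟨h a (by simp), ih fun b hb => h b (by simp [hb])⟩

theorem avg_eq_of_sum_eq (hw : ∀ s, ∀ m ∈ mv s, m.1 ≠ 0 ∧ m.1 ≠ ⊤) {s : S} (hs : mv s ≠ [])
    {φ : S → ℝ≥0∞} {c : ℝ≥0∞}
    (h : ((mv s).map fun m => m.1 * φ m.2).sum = ((mv s).map fun m => m.1).sum * c) :
    avg mv φ s = c := by
  rw [avg, h, mul_comm, ENNReal.mul_div_cancel_right]
  · exact list_sum_ne_zero hs fun m hm => (hw s m hm).1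
  · exact list_sum_ne_top fun m hm => (hw s m hm).2

/-- A chain with a harmonic function `h` that dominates the (strictly increasing) size of the
state up to a factor `4`, and is dominated by it up to a factor `C`. -/
structure Controlled (mv : S → List (ℝ≥0∞ × S)) (I : S → Prop) (h : S → ℝ≥0) (size : S → ℕ)
    (C : ℝ≥0) : Prop where
  inv : ∀ s, I s → ∀ m ∈ mv s, I m.2
  weight : ∀ s, ∀ m ∈ mv s, m.1 ≠ 0 ∧ m.1 ≠ ⊤
  harmonic : ∀ s, I s → ((mv s).map fun m => m.1 * (h m.2 : ℝ≥0∞)).sum =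
    ((mv s).map fun m => m.1).sum * (h s : ℝ≥0∞)
  size_succ : ∀ s, I s → ∀ m ∈ mv s, size m.2 = size s + 1
  size_le : ∀ s, I s → (size s : ℝ≥0) ≤ 4 * h s
  le_size : ∀ s, I s → h s ≤ C * (size s + 1)

namespace Controlled

variable {h : S → ℝ≥0} {size : S → ℕ} {C : ℝ≥0}

theorem avg_one (D : Controlled mv I h size C) : avg mv 1 = running mv := by
  funext s
  by_cases hs : mv s = []
  · simp [avg_of_nil hs, running, hs]
  · rw [avg_eq_of_sum_eq D.weight hs (c := 1) (by simp)]
    simp [running, hs]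

/-- Every move raises the size by exactly one, so the size factor is constant over the moves from
`s` and leaves the average. Iterated, it turns the size after `k` steps into `size s + k` times the
probability of surviving `k` steps. -/
theorem avg_size_mul (D : Controlled mv I h size C) (φ : S → ℝ≥0∞) (c : ℝ≥0∞) {s : S}
    (hs : I s) :
    avg mv (fun s => (size s + c) * φ s) s = (size s + 1 + c) * avg mv φ s := by
  have : ((mv s).map fun m => m.1 * ((size m.2 + c) * φ m.2)) =
      (mv s).map fun m => (size s + 1 + c) * (m.1 * φ m.2) := by
    refine List.map_congr_left fun m hm => ?_
    rw [D.size_succ s hs m hm]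
    push_cast
    ring
  rw [avg, this, List.sum_map_mul_left, mul_div_assoc, avg]

theorem iterate_avg_size (D : Controlled mv I h size C) (k : ℕ) (c : ℝ≥0∞) {s : S} (hs : I s) :
    (avg mv)^[k] (fun s => size s + c) s = (size s + k + c) * (avg mv)^[k] 1 s := by
  induction k generalizing s with
  | zero => simp
  | succ k ih =>
    rw [Function.iterate_succ_apply', Function.iterate_succ_apply']
    have e1 := le_antisymm
      (avg_mono D.inv (φ := (avg mv)^[k] fun s => size s + c)
        (ψ := fun s => (size s + (k + c)) * (avg mv)^[k] 1 s)
        (fun s hs => by rw [ih hs, add_assoc]) s hs)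
      (avg_mono D.inv (ψ := (avg mv)^[k] fun s => size s + c)
        (φ := fun s => (size s + (k + c)) * (avg mv)^[k] 1 s)
        (fun s hs => by rw [ih hs, add_assoc]) s hs)
    rw [e1, D.avg_size_mul _ _ hs]
    push_cast
    ring

/-- A drift argument: `4 * h - size` is nonnegative and its mean drops by one per move, since `h` is
harmonic. The left side counts the expected number of moves made in the first `N` rounds. -/
theorem sum_running_le (D : Controlled mv I h size C) (N : ℕ) {s : S} (hs : I s) :
    ∑ k ∈ Finset.range N, (avg mv)^[k] (running mv) s ≤ 4 * h s := by
  set u : S → ℝ≥0∞ := fun s => ((4 * h s - size s : ℝ≥0) : ℝ≥0∞) with hu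
  have hus : ∀ s, I s → u s + size s = 4 * h s := by
    intro s hs
    have : (4 * h s - size s : ℝ≥0) + size s = 4 * h s := tsub_add_cancel_of_le (D.size_le s hs)
    simp only [hu]
    exact_mod_cast this
  have hstep : ∀ s, I s → (running mv + avg mv u) s ≤ u s := by
    intro s hs
    by_cases h0 : mv s = []
    · simp [running, h0, avg_of_nil h0]
    have e1 : avg mv (fun s => 4 * (h s : ℝ≥0∞)) s = 4 * h s := by
      rw [avg_smul]
      beta_reduce
      rw [avg_eq_of_sum_eq D.weight h0 (φ := fun s => (h s : ℝ≥0∞)) (D.harmonic s hs)]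
    have e2 : avg mv (u + fun s => (size s : ℝ≥0∞)) s = 4 * h s := by
      rw [← e1]
      exact le_antisymm (avg_mono D.inv (fun s hs => (hus s hs).le) s hs)
        (avg_mono D.inv (fun s hs => (hus s hs).ge) s hs)
    have e3 : avg mv (fun s => (size s : ℝ≥0∞)) s = size s + 1 := by
      have := D.avg_size_mul 1 0 hs
      simpa [D.avg_one, running, h0] using this
    rw [avg_add, Pi.add_apply, e3, ← hus s hs] at e2
    have e4 : (running mv + avg mv u) s + size s = u s + size s := by
      rw [← e2, Pi.add_apply, running, if_neg h0]
      ring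
    exact ((ENNReal.add_left_inj (ENNReal.natCast_ne_top _)).1 e4).le
  have key : ∀ N, ∀ s, I s →
      ∑ k ∈ Finset.range N, (avg mv)^[k] (running mv) s + (avg mv)^[N] u s ≤ u s := by
    intro N
    induction N with
    | zero => intro s hs; simp
    | succ N ih =>
      intro s hs
      refine le_trans ?_ (ih s hs)
      rw [Finset.sum_range_succ, add_assoc]
      gcongr
      have := iterate_avg_mono D.inv N hstep s hs
      rwa [iterate_avg_add, Pi.add_apply, ← Function.iterate_succ_apply] at this
  calc _ ≤ u s := le_trans le_self_add (key N s hs)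
    _ ≤ u s + size s := le_self_add
    _ = _ := hus s hs

/-- The survival probabilities `f k` decrease and are summable, so `N * f (2 * N)` is at most the
tail of the series from `N` on, which tends to zero. Even indices of `f` suffice, as a subsequence
is all that optional stopping needs. -/
theorem tendsto_size_mul (D : Controlled mv I h size C) {s : S} (hs : I s) :
    Tendsto (fun N : ℕ => ((size s : ℝ≥0∞) + (2 * N + 1 : ℕ) + 1) * (avg mv)^[2 * N + 1] 1 s) atTop
      (nhds 0) := by
  set f : ℕ → ℝ≥0∞ := fun k => (avg mv)^[k] (running mv) s with hf
  have hf1 : ∀ k, (avg mv)^[k + 1] 1 s = f k := by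
    intro k
    rw [Function.iterate_succ_apply, D.avg_one]
  have hsum : ∑' k, f k ≠ ⊤ := by
    refine ne_top_of_le_ne_top (b := 4 * (h s : ℝ≥0∞)) ?_ ?_
    · exact ENNReal.mul_ne_top (by simp) ENNReal.coe_ne_top
    · rw [ENNReal.tsum_eq_iSup_nat]
      exact iSup_le fun N => D.sum_running_le N hs
  have hanti : Antitone f := by
    refine antitone_nat_of_succ_le fun k => ?_
    simp only [hf, Function.iterate_succ_apply]
    refine iterate_avg_mono D.inv k (fun s hs => ?_) s hs
    rw [← D.avg_one]
    refine avg_mono D.inv (fun s _ => ?_) s hs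
    rw [D.avg_one, running]
    split_ifs <;> simp
  have h1 := ENNReal.tendsto_sum_nat_add f hsum
  have hN : ∀ N : ℕ, (N : ℝ≥0∞) * f (2 * N) ≤ ∑' k, f (k + N) := by
    intro N
    calc (N : ℝ≥0∞) * f (2 * N) = ∑ k ∈ Finset.range N, f (2 * N) := by simp
      _ ≤ ∑ k ∈ Finset.range N, f (k + N) := by
        refine Finset.sum_le_sum fun k hk => hanti ?_
        have := Finset.mem_range.1 hk
        omega
      _ ≤ _ := ENNReal.sum_le_tsum _
  have h2 : ∀ N : ℕ, f (2 * N) ≤ ∑' k, f (k + N) := by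
    intro N
    have : f (2 * N) = f (N + N) := by congr 1; omega
    rw [this]
    exact ENNReal.le_tsum (f := fun k => f (k + N)) N
  refine tendsto_of_tendsto_of_tendsto_of_le_of_le tendsto_const_nhds
    (h := fun N : ℕ => ((size s : ℝ≥0∞) + 4) * ∑' k, f (k + N)) ?_ (fun _ => bot_le) ?_
  · have := ENNReal.Tendsto.const_mul (a := (size s : ℝ≥0∞) + 4) h1
      (Or.inr (ENNReal.add_ne_top.2 ⟨ENNReal.natCast_ne_top _, by simp⟩))
    simpa using this
  · intro N
    simp only [hf1]
    calc ((size s : ℝ≥0∞) + (2 * N + 1 : ℕ) + 1) * f (2 * N)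
        = (size s + 2) * f (2 * N) + 2 * (N * f (2 * N)) := by push_cast; ring
      _ ≤ (size s + 2) * ∑' k, f (k + N) + 2 * ∑' k, f (k + N) := by
        gcongr
        · exact h2 N
        · exact hN N
      _ = _ := by ring

/-- The total contribution of a harmonic function of linear growth at the stopping time. -/
theorem tsum_stopped (D : Controlled mv I h size C) {φ : S → ℝ≥0∞}
    (hφ : ∀ s, I s → φ s = stopped mv s * φ s + avg mv φ s) {c : ℝ≥0}
    (hc : ∀ s, I s → φ s ≤ c * (size s + 1)) {s : S} (hs : I s) :
    ∑' k, (avg mv)^[k] (fun s => stopped mv s * φ s) s = φ s := by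
  -- Telescoping: `φ s` equals what was collected at stops before time `N` plus the mean of `φ` over
  -- the paths that made `N` moves.
  have key : ∀ N, ∀ s, I s → ∑ k ∈ Finset.range N, (avg mv)^[k] (fun s => stopped mv s * φ s) s +
      (avg mv)^[N] φ s = φ s := by
    intro N
    induction N with
    | zero => intro s hs; simp
    | succ N ih =>
      intro s hs
      rw [← ih s hs, Finset.sum_range_succ, add_assoc]
      congr 1
      have := iterate_avg_congr D.inv N (φ := φ)
        (ψ := (fun s => stopped mv s * φ s) + avg mv φ) hφ s hs
      rw [this, iterate_avg_add, Pi.add_apply, ← Function.iterate_succ_apply]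
  refine le_antisymm ?_ ?_
  · rw [ENNReal.tsum_eq_iSup_nat]
    exact iSup_le fun N => le_trans le_self_add (key N s hs).le
  -- Linear growth bounds the remainder by the size at that time times the survival probability,
  -- which vanishes along odd times.
  · have hle : ∀ N : ℕ, φ s ≤ ∑' k, (avg mv)^[k] (fun s => stopped mv s * φ s) s +
        c * (((size s : ℝ≥0∞) + (2 * N + 1 : ℕ) + 1) * (avg mv)^[2 * N + 1] 1 s) := by
      intro N
      rw [← D.iterate_avg_size _ 1 hs]
      conv_lhs => rw [← key (2 * N + 1) s hs]
      gcongr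
      · exact ENNReal.sum_le_tsum _
      · have := iterate_avg_mono D.inv (2 * N + 1) hc s hs
        rwa [iterate_avg_smul] at this
    have ht : Tendsto (fun N : ℕ => ∑' k, (avg mv)^[k] (fun s => stopped mv s * φ s) s +
        c * (((size s : ℝ≥0∞) + (2 * N + 1 : ℕ) + 1) * (avg mv)^[2 * N + 1] 1 s)) atTop
        (nhds (∑' k, (avg mv)^[k] (fun s => stopped mv s * φ s) s + c * 0)) :=
      tendsto_const_nhds.add
        (ENNReal.Tendsto.const_mul (D.tendsto_size_mul hs) (Or.inr ENNReal.coe_ne_top))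
    rw [mul_zero, add_zero] at ht
    exact ge_of_tendsto' ht hle

theorem tsum_stopped_one (D : Controlled mv I h size C) {s : S} (hs : I s) :
    ∑' k, (avg mv)^[k] (stopped mv) s = 1 := by
  have := D.tsum_stopped (φ := 1) (c := 1) (fun s _ => ?_) (fun s _ => by simp) hs
  · simpa using this
  · rw [D.avg_one, stopped, running]
    split_ifs <;> simp

theorem tsum_stopped_harmonic (D : Controlled mv I h size C) {s : S} (hs : I s) :
    ∑' k, (avg mv)^[k] (fun s => stopped mv s * h s) s = h s := by
  refine D.tsum_stopped (c := C) (fun s hs => ?_) (fun s hs => ?_) hs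
  · by_cases h0 : mv s = []
    · simp [stopped, h0, avg_of_nil h0]
    · rw [avg_eq_of_sum_eq D.weight h0 (φ := fun s => (h s : ℝ≥0∞)) (D.harmonic s hs)]
      simp [stopped, h0]
  · exact_mod_cast D.le_size s hs

end Controlled

/-- Reachability along moves. -/
def Reaches (mv : S → List (ℝ≥0∞ × S)) : S → S → Prop :=
  Relation.ReflTransGen fun s s' => ∃ m ∈ mv s, m.2 = s'

theorem exists_reaches_of_iterate_ne_zero (k : ℕ) {φ : S → ℝ≥0∞} {s : S}
    (h : (avg mv)^[k] φ s ≠ 0) : ∃ s', Reaches mv s s' ∧ φ s' ≠ 0 := by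
  induction k generalizing s with
  | zero => exact ⟨s, Relation.ReflTransGen.refl, h⟩
  | succ k ih =>
    rw [Function.iterate_succ_apply'] at h
    have : ∃ m ∈ mv s, (avg mv)^[k] φ m.2 ≠ 0 := by
      by_contra! hc
      refine h ?_
      rw [avg, List.sum_eq_zero, ENNReal.zero_div]
      intro x hx
      obtain ⟨m, hm, rfl⟩ := List.mem_map.1 hx
      rw [hc m hm, mul_zero]
    obtain ⟨m, hm, h0⟩ := this
    obtain ⟨s', h1, h2⟩ := ih h0
    exact ⟨s', Relation.ReflTransGen.head ⟨m, hm, rfl⟩ h1, h2⟩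

/-- Stopping has total probability one, so some stopped state carries positive mass at some time and
is hence actually reachable. -/
theorem Controlled.exists_stopped {h : S → ℝ≥0} {size : S → ℕ} {C : ℝ≥0}
    (D : Controlled mv I h size C) {s : S} (hs : I s) : ∃ s', Reaches mv s s' ∧ mv s' = [] := by
  have h1 := D.tsum_stopped_one hs
  have : ∃ k, (avg mv)^[k] (stopped mv) s ≠ 0 := by
    by_contra! hc
    simp [hc] at h1
  obtain ⟨k, hk⟩ := this
  obtain ⟨s', h2, h3⟩ := exists_reaches_of_iterate_ne_zero k hk
  refine ⟨s', h2, ?_⟩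
  by_contra h4
  exact h3 (by simp [stopped, h4])

end Avg

/-! ### Stability under the attachment of a single tile -/

namespace Dir

theorem opp_opp (d : Dir) : d.opp.opp = d := by cases d <;> rfl

theorem vec_opp (d : Dir) : d.opp.vec = -d.vec := by cases d <;> rfl

theorem vec_ne_zero (d : Dir) : d.vec ≠ 0 := by cases d <;> simp [vec, Prod.ext_iff]

theorem univ_eq : (Finset.univ : Finset Dir) = {north, east, south, west} := rfl

theorem sum_univ {M : Type*} [AddCommMonoid M] (f : Dir → M) :
    ∑ d, f d = f north + f east + f south + f west := by
  rw [univ_eq, Finset.sum_insert (by decide), Finset.sum_insert (by decide),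
    Finset.sum_insert (by decide), Finset.sum_singleton]
  simp only [add_assoc]

/-- Reversal of directions. -/
def oppEquiv : Dir ≃ Dir := ⟨opp, opp, opp_opp, opp_opp⟩

end Dir

namespace Assembly

variable {G : Type} {str : G → ℕ} {α : Assembly G} {p : ℤ × ℤ} {t : Tile G}

/-- The total strength with which a tile of type `t` at the position `p` would bind to `α`. -/
def binding (str : G → ℕ) (α : Assembly G) (p : ℤ × ℤ) (t : Tile G) : ℕ :=
  ∑ d : Dir, match α (p + d.vec) with
    | some b => if t.glue d = b.glue d.opp then str (t.glue d) else 0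
    | none => 0

theorem add_self (α : Assembly G) (p : ℤ × ℤ) (t : Tile G) : α.add p t p = some t := by
  simp [add]

theorem add_of_ne (α : Assembly G) (t : Tile G) {q : ℤ × ℤ} (h : q ≠ p) : α.add p t q = α q := by
  simp [add, h]

theorem dom_add (α : Assembly G) (p : ℤ × ℤ) (t : Tile G) : (α.add p t).dom = insert p α.dom := by
  ext q
  by_cases h : q = p
  · subst h; simp [dom, add_self]
  · simp [dom, add_of_ne α t h, h]

theorem add_vec_ne (p : ℤ × ℤ) (d : Dir) : p + d.vec ≠ p := by
  simpa using d.vec_ne_zero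

theorem bond_add_self (str : G → ℕ) (α : Assembly G) (p : ℤ × ℤ) (t : Tile G) (d : Dir) :
    bond str (α.add p t) p d = match α (p + d.vec) with
    | some b => if t.glue d = b.glue d.opp then str (t.glue d) else 0
    | none => 0 := by
  rw [bond, add_self, add_of_ne α t (add_vec_ne p d)]
  cases α (p + d.vec) <;> rfl

theorem binding_eq (str : G → ℕ) (α : Assembly G) (p : ℤ × ℤ) (t : Tile G) :
    binding str α p t = ∑ d, bond str (α.add p t) p d := by
  simp only [bond_add_self, binding]

theorem bond_symm (str : G → ℕ) (α : Assembly G) (p : ℤ × ℤ) (d : Dir) :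
    bond str α (p + d.vec) d.opp = bond str α p d := by
  rw [bond, bond, Dir.vec_opp, add_neg_cancel_right, Dir.opp_opp]
  cases h : α p <;> cases h' : α (p + d.vec) <;> simp
  rename_i a b
  by_cases e : a.glue d = b.glue d.opp
  · simp [e]
  · simp [e, Ne.symm e]

theorem bond_add_of_ne {q : ℤ × ℤ} (d : Dir) (h1 : q ≠ p) (h2 : q + d.vec ≠ p) :
    bond str (α.add p t) q d = bond str α q d := by
  simp only [bond, add_of_ne α t h1, add_of_ne α t h2]

theorem bond_eq_zero_of_right {q : ℤ × ℤ} (d : Dir) (h : α (q + d.vec) = none) :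
    bond str α q d = 0 := by
  simp only [bond, h]
  cases α q <;> rfl

/-- The same edges are counted from either endpoint; reversing the direction exchanges the two
counts. -/
theorem sum_bond_to (str : G → ℕ) (α : Assembly G) (p : ℤ × ℤ) (S : Finset (ℤ × ℤ)) :
    ∑ q ∈ S, ∑ d : Dir, (if q + d.vec = p then bond str α q d else 0) =
      ∑ d : Dir, if p + d.vec ∈ S then bond str α p d else 0 := by
  rw [Finset.sum_comm, ← Dir.oppEquiv.sum_comp]
  refine Finset.sum_congr rfl fun d _ => ?_
  change ∑ q ∈ S, (if q + d.opp.vec = p then bond str α q d.opp else 0) = _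
  have : ∀ q, (if q + d.opp.vec = p then bond str α q d.opp else 0) =
      if q = p + d.vec then bond str α p d else 0 := by
    intro q
    by_cases h : q = p + d.vec
    · rw [if_pos h, h, if_pos, bond_symm]
      rw [Dir.vec_opp]; abel
    · rw [if_neg h, if_neg]
      rintro h'
      apply h
      rw [← h', Dir.vec_opp]; abel
  simp only [this, Finset.sum_ite_eq']

/-- A tile can be added to a stable assembly iff it binds with strength at least `τ`. -/
theorem stable_add_iff {τ : ℕ} (hα : α.Stable str τ) (hne : α.dom.Nonempty) (hp : α p = none) :
    (α.add p t).Stable str τ ↔ τ ≤ binding str α p t := by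
  rw [binding_eq]
  have hpd : p ∉ α.dom := by simp [dom, hp]
  have hsub : ∀ q ∈ α.dom, q ≠ p := fun q hq h => hpd (h ▸ hq)
  have hsingle : cutWeight str (α.add p t) {p} = ∑ d, bond str (α.add p t) p d := by
    simp only [cutWeight, Finset.sum_singleton, Finset.mem_singleton, add_vec_ne, if_false]
  constructor
  · intro h
    rw [← hsingle]
    refine h {p} (Finset.singleton_nonempty p) ?_
    rw [dom_add, Finset.coe_singleton]
    obtain ⟨q, hq⟩ := hne
    refine ⟨by simp, fun h' => ?_⟩
    exact hsub q hq (h' (Set.mem_insert_of_mem _ hq))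
  · intro h S hS hSd
    rw [dom_add] at hSd
    -- A cut isolating the new tile weighs exactly its binding strength. Every other cut restricts
    -- to a proper cut of the old assembly, and the new tile only adds weight to it.
    by_cases hpS : p ∈ S
    · by_cases hS1 : S = {p}
      · rw [hS1, hsingle]; exact h
      have h1 : (S.erase p).Nonempty := by
        rw [Finset.nonempty_iff_ne_empty]
        intro he
        rw [Finset.erase_eq_empty_iff] at he
        rcases he with he | he
        · exact hS.ne_empty he
        · exact hS1 he
      have h2 : ((S.erase p : Finset _) : Set (ℤ × ℤ)) ⊂ α.dom := by
        refine ⟨fun q hq => ?_, fun hc => hSd.2 fun q hq => ?_⟩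
        · rw [Finset.mem_coe, Finset.mem_erase] at hq
          exact (hSd.1 hq.2).resolve_left hq.1
        · rcases hq with rfl | hq
          · exact hpS
          · exact Finset.mem_of_mem_erase (hc hq)
      refine (hα _ h1 h2).trans ?_
      rw [cutWeight, cutWeight, ← Finset.add_sum_erase _ _ hpS]
      refine le_trans (Finset.sum_le_sum fun q hq => Finset.sum_le_sum fun d _ => ?_)
        (Nat.le_add_left _ _)
      have hqp := (Finset.mem_erase.1 hq).1
      by_cases hd : q + d.vec = p
      · rw [bond_eq_zero_of_right d (by rw [hd, hp])]
        split_ifs <;> exact Nat.zero_le _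
      · rw [bond_add_of_ne d hqp hd]
        simp [Finset.mem_erase, hd]
    · have hSd' : (S : Set (ℤ × ℤ)) ⊆ α.dom := fun q hq =>
        (hSd.1 hq).resolve_left fun h => hpS (h ▸ hq)
      -- If `S` is the whole old assembly, its complement is the new tile, so this is the isolating
      -- cut seen from the other side.
      by_cases hS1 : (S : Set (ℤ × ℤ)) = α.dom
      · have hmem : ∀ q, q ∉ S → α q = none := by
          intro q hq
          by_contra hc
          exact hq (Finset.mem_coe.1 (hS1 ▸ hc))
        have : cutWeight str (α.add p t) S =
            ∑ q ∈ S, ∑ d : Dir, (if q + d.vec = p then bond str (α.add p t) q d else 0) := by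
          refine Finset.sum_congr rfl fun q hq => Finset.sum_congr rfl fun d _ => ?_
          by_cases h1 : q + d.vec = p
          · rw [if_pos h1, if_neg (h1 ▸ hpS)]
          · rw [if_neg h1]
            split_ifs with h2
            · rfl
            · refine bond_eq_zero_of_right d ?_
              rw [add_of_ne α t h1, hmem _ h2]
        rw [this, sum_bond_to]
        refine h.trans (Finset.sum_le_sum fun d _ => ?_)
        split_ifs with h1
        · exact le_rfl
        · rw [bond_eq_zero_of_right d]
          rw [add_of_ne α t (add_vec_ne p d), hmem _ h1]
      · refine (hα S hS (hSd'.ssubset_of_ne hS1)).trans ?_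
        refine Finset.sum_le_sum fun q hq => Finset.sum_le_sum fun d _ => ?_
        by_cases hd : q + d.vec = p
        · rw [bond_eq_zero_of_right d (by rw [hd, hp])]
          split_ifs <;> exact Nat.zero_le _
        · rw [bond_add_of_ne d (hsub q (hSd' hq)) hd]

theorem add_injective_pos {p q : ℤ × ℤ} (hp : α p = none) (h : α.add p t = α.add q t) : p = q := by
  by_contra hne
  have := congrFun h p
  rw [add_self, add_of_ne α t hne, hp] at this
  exact absurd this (by simp)

end Assembly

/-! ### Simulating the assembly process by explicit lists of moves -/

namespace TileSystem

variable {Γ : TileSystem}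

/-- A tile of type `t` can attach to `A` at the position `p`. -/
def Attachable (Γ : TileSystem) (A : Assembly Γ.Glue) (p : ℤ × ℤ) (t : Tile Γ.Glue) : Prop :=
  t ∈ Γ.tiles ∧ A p = none ∧ (A.add p t).Stable Γ.str Γ.temp

theorem attach_iff {A B : Assembly Γ.Glue} {t : Tile Γ.Glue} :
    Γ.Attach A t B ↔ ∃ p, Γ.Attachable A p t ∧ B = A.add p t := by
  constructor
  · rintro ⟨ht, p, hp, rfl, hB⟩
    exact ⟨p, ⟨ht, hp, hB⟩, rfl⟩
  · rintro ⟨p, ⟨ht, hp, hB⟩, rfl⟩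
    exact ⟨ht, p, hp, rfl, hB⟩

variable {S : Type*}

/-- A system of configurations `s` with list of moves `mv s` that simulates the assembly
process of `Γ`. -/
structure Simulation (Γ : TileSystem) (asm : S → Assembly Γ.Glue)
    (mv : S → List (((ℤ × ℤ) × Tile Γ.Glue) × S)) (I : S → Prop) (s₀ : S) : Prop where
  start_eq : asm s₀ = Γ.seed
  inv_start : I s₀
  attachable : ∀ s, I s → ∀ p t, Γ.Attachable (asm s) p t ↔ ∃ s', ((p, t), s') ∈ mv s
  nodup : ∀ s, I s → ((mv s).map Prod.fst).Nodup
  step : ∀ s, I s → ∀ m ∈ mv s, asm m.2 = (asm s).add m.1.1 m.1.2 ∧ I m.2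

/-- The moves, weighted by the concentrations. -/
def weighted (P : Tile Γ.Glue → ℝ≥0) (mv : S → List (((ℤ × ℤ) × Tile Γ.Glue) × S)) (s : S) :
    List (ℝ≥0∞ × S) :=
  (mv s).map fun m => ((P m.1.2 : ℝ≥0∞), m.2)

namespace Simulation

variable {asm : S → Assembly Γ.Glue} {mv : S → List (((ℤ × ℤ) × Tile Γ.Glue) × S)}
  {I : S → Prop} {s₀ : S}

/-- It suffices to look at the binding strengths. -/
theorem of_binding (start_eq : asm s₀ = Γ.seed) (inv_start : I s₀)
    (hne : ∀ s, I s → (asm s).dom.Nonempty)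
    (attachable : ∀ s, I s → ∀ p t, (t ∈ Γ.tiles ∧ asm s p = none ∧
      Γ.temp ≤ (asm s).binding Γ.str p t) ↔ ∃ s', ((p, t), s') ∈ mv s)
    (nodup : ∀ s, I s → ((mv s).map Prod.fst).Nodup)
    (step : ∀ s, I s → ∀ m ∈ mv s, asm m.2 = (asm s).add m.1.1 m.1.2 ∧ I m.2) :
    Simulation Γ asm mv (fun s => I s ∧ (asm s).Stable Γ.str Γ.temp) s₀ := by
  have h1 : ∀ s, I s ∧ (asm s).Stable Γ.str Γ.temp → ∀ p t, Γ.Attachable (asm s) p t ↔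
      ∃ s', ((p, t), s') ∈ mv s := by
    rintro s ⟨hs, hst⟩ p t
    rw [← attachable s hs]
    refine and_congr_right fun _ => and_congr_right fun hp => ?_
    exact Assembly.stable_add_iff hst (hne s hs) hp
  refine ⟨start_eq, ⟨inv_start, start_eq ▸ Γ.seed_stable⟩, h1, fun s hs => nodup s hs.1, ?_⟩
  intro s hs m hm
  have h2 := step s hs.1 m hm
  refine ⟨h2.1, h2.2, ?_⟩
  rw [h2.1]
  exact ((h1 s hs m.1.1 m.1.2).2 ⟨m.2, hm⟩).2.2

/-- The target assembly and the tile type determine the position, so the tile types counted in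
`weight` correspond bijectively to the moves with that target. The absence of duplicates in the move
list makes each of them count once. -/
theorem tsum_weight (M : Simulation Γ asm mv I s₀) (P : Tile Γ.Glue → ℝ≥0)
    (g : Assembly Γ.Glue → ℝ≥0∞) {s : S} (hs : I s) :
    ∑' B, Γ.weight P (asm s) B * g B =
      ((weighted P mv s).map fun m => m.1 * g (asm m.2)).sum := by
  have h1 : ∀ B, Γ.weight P (asm s) B =
      ((mv s).map fun m => if B = asm m.2 then (P m.1.2 : ℝ≥0∞) else 0).sum := by
    intro B
    have e1 : ((mv s).map fun m => if B = asm m.2 then (P m.1.2 : ℝ≥0∞) else 0) =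
        ((mv s).map Prod.fst).map fun a =>
          if B = (asm s).add a.1 a.2 then (P a.2 : ℝ≥0∞) else 0 := by
      rw [List.map_map]
      refine List.map_congr_left fun m hm => ?_
      rw [(M.step s hs m hm).1]
      rfl
    rw [e1, ← List.sum_toFinset _ (M.nodup s hs)]
    have hmem : ∀ p t, (p, t) ∈ ((mv s).map Prod.fst).toFinset ↔ Γ.Attachable (asm s) p t := by
      intro p t
      rw [M.attachable s hs, List.mem_toFinset, List.mem_map]
      constructor
      · rintro ⟨⟨a, s'⟩, h, rfl⟩
        exact ⟨s', h⟩
      · rintro ⟨s', h⟩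
        exact ⟨_, h, rfl⟩
    rw [weight, ← Finset.sum_filter, ← Finset.sum_filter]
    -- The value `(0, t)` is a dummy: on the filtered set a position always exists.
    refine Finset.sum_bij' (fun t ht => (if h : ∃ p, Γ.Attachable (asm s) p t ∧
      B = (asm s).add p t then (h.choose, t) else (0, t))) (fun a _ => a.2) ?_ ?_ ?_ ?_ ?_
    · intro t ht
      have h := attach_iff.1 (Finset.mem_filter.1 ht).2
      rw [dif_pos h, Finset.mem_filter, hmem]
      exact h.choose_spec
    · rintro ⟨p, t⟩ ha
      rw [Finset.mem_filter, hmem] at ha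
      exact Finset.mem_filter.2 ⟨ha.1.1, attach_iff.2 ⟨p, ha⟩⟩
    · intro t ht
      split_ifs <;> rfl
    · rintro ⟨p, t⟩ ha
      rw [Finset.mem_filter, hmem] at ha
      have h : ∃ p, Γ.Attachable (asm s) p t ∧ B = (asm s).add p t := ⟨p, ha⟩
      dsimp only
      rw [dif_pos h]
      congr 1
      refine Assembly.add_injective_pos h.choose_spec.1.2.1 (t := t) ?_
      rw [← h.choose_spec.2]
      exact ha.2
    · intro t ht
      split_ifs <;> rfl
  simp only [h1, weighted, List.map_map]
  induction mv s with
  | nil => simp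
  | cons m l ih =>
    simp only [List.map_cons, List.sum_cons, add_mul, ENNReal.tsum_add, ih]
    congr 1
    simp only [ite_mul, zero_mul]
    rw [tsum_ite_eq (asm m.2) fun B => (P m.1.2 : ℝ≥0∞) * g B]
    rfl

theorem tsum_trans (M : Simulation Γ asm mv I s₀) (P : Tile Γ.Glue → ℝ≥0)
    (g : Assembly Γ.Glue → ℝ≥0∞) {s : S} (hs : I s) :
    ∑' B, Γ.trans P (asm s) B * g B = avg (weighted P mv) (g ∘ asm) s := by
  have h1 := M.tsum_weight P (fun _ => 1) hs
  simp only [mul_one] at h1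
  simp only [trans, h1, avg]
  have h2 := M.tsum_weight P g hs
  simp only [Function.comp_apply]
  rw [ENNReal.div_eq_inv_mul, ← h2, ← ENNReal.tsum_mul_left]
  refine tsum_congr fun B => ?_
  rw [ENNReal.div_eq_inv_mul, mul_assoc]

theorem inv_weighted (M : Simulation Γ asm mv I s₀) (P : Tile Γ.Glue → ℝ≥0) :
    ∀ s, I s → ∀ m ∈ weighted P mv s, I m.2 := by
  intro s hs m hm
  obtain ⟨a, ha, rfl⟩ := List.mem_map.1 hm
  exact (M.step s hs a ha).2

/-- Duality: instead of pushing the distribution forward, the test function is pulled back along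
`avg`. Hence `asm` need not be injective; several configurations may represent one assembly. -/
theorem tsum_probAt (M : Simulation Γ asm mv I s₀) (P : Tile Γ.Glue → ℝ≥0) (k : ℕ)
    (g : Assembly Γ.Glue → ℝ≥0∞) :
    ∑' A, Γ.probAt P k A * g A = (avg (weighted P mv))^[k] (g ∘ asm) s₀ := by
  induction k generalizing g with
  | zero =>
    simp only [probAt, ite_mul, one_mul, zero_mul, tsum_ite_eq, Function.iterate_zero, id,
      Function.comp, M.start_eq]
  | succ k ih =>
    have h1 : ∀ B, Γ.probAt P (k + 1) B * g B =
        ∑' A, Γ.probAt P k A * (Γ.trans P A B * g B) := by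
      intro B
      rw [probAt, ← ENNReal.tsum_mul_right]
      simp only [mul_assoc]
    simp only [h1]
    rw [ENNReal.tsum_comm]
    simp only [ENNReal.tsum_mul_left]
    rw [ih fun A => ∑' B, Γ.trans P A B * g B, Function.iterate_succ_apply]
    exact iterate_avg_congr (M.inv_weighted P) k (fun s hs => M.tsum_trans P g hs) s₀ M.inv_start

theorem producible_iff (M : Simulation Γ asm mv I s₀) {A : Assembly Γ.Glue} :
    Γ.Producible A → ∃ s, I s ∧ asm s = A := by
  intro h
  induction h with
  | refl => exact ⟨s₀, M.inv_start, M.start_eq⟩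
  | tail _ hstep ih =>
    obtain ⟨s, hs, rfl⟩ := ih
    obtain ⟨t, ht⟩ := hstep
    obtain ⟨p, hp, rfl⟩ := attach_iff.1 ht
    obtain ⟨s', hs'⟩ := (M.attachable s hs p t).1 hp
    exact ⟨s', (M.step s hs _ hs').2, (M.step s hs _ hs').1⟩

theorem grows_of_reaches (M : Simulation Γ asm mv I s₀) (P : Tile Γ.Glue → ℝ≥0) {s s' : S}
    (hs : I s) (h : Reaches (weighted P mv) s s') : Γ.Grows (asm s) (asm s') ∧ I s' := by
  induction h with
  | refl => exact ⟨Relation.ReflTransGen.refl, hs⟩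
  | tail _ hstep ih =>
    obtain ⟨m, hm, rfl⟩ := hstep
    obtain ⟨⟨⟨p, t⟩, s'⟩, ha, rfl⟩ := List.mem_map.1 hm
    have h1 := M.step _ ih.2 _ ha
    refine ⟨ih.1.tail ⟨t, attach_iff.2 ⟨p, ?_, h1.1⟩⟩, h1.2⟩
    exact (M.attachable _ ih.2 p t).2 ⟨s', ha⟩

theorem stuck_iff (M : Simulation Γ asm mv I s₀) {s : S} (hs : I s) :
    (∀ B, ¬ Γ.Step (asm s) B) ↔ mv s = [] := by
  constructor
  · intro h
    by_contra hne
    obtain ⟨⟨⟨p, t⟩, s'⟩, hm⟩ := List.exists_mem_of_ne_nil _ hne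
    exact h _ ⟨t, attach_iff.2 ⟨p, (M.attachable s hs p t).2 ⟨s', hm⟩, rfl⟩⟩
  · rintro h B ⟨t, ht⟩
    obtain ⟨p, hp, -⟩ := attach_iff.1 ht
    obtain ⟨s', hm⟩ := (M.attachable s hs p t).1 hp
    simp [h] at hm

/-- With producibility in the invariant, being terminal reduces to having no moves. -/
theorem producible_inv (M : Simulation Γ asm mv I s₀) :
    Simulation Γ asm mv (fun s => I s ∧ Γ.Producible (asm s)) s₀ where
  start_eq := M.start_eq
  inv_start := ⟨M.inv_start, by rw [M.start_eq]; exact Relation.ReflTransGen.refl⟩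
  attachable s hs := M.attachable s hs.1
  nodup s hs := M.nodup s hs.1
  step s hs m hm := by
    have h1 := M.step s hs.1 m hm
    refine ⟨h1.1, h1.2, hs.2.tail ⟨m.1.2, attach_iff.2 ⟨m.1.1, ?_, h1.1⟩⟩⟩
    exact (M.attachable s hs.1 _ _).2 ⟨m.2, hm⟩

variable {h : S → ℝ≥0} {size : S → ℕ} {C : ℝ≥0} {P : Tile Γ.Glue → ℝ≥0}

theorem isFinite (M : Simulation Γ asm mv I s₀)
    (D : Controlled (weighted P mv) I h size C) : Γ.IsFinite := by
  intro B hB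
  obtain ⟨s, hs, rfl⟩ := M.producible_iff hB
  obtain ⟨s', h1, h2⟩ := D.exists_stopped hs
  obtain ⟨h3, h4⟩ := M.grows_of_reaches P hs h1
  refine ⟨asm s', ⟨hB.trans h3, (M.stuck_iff h4).2 ?_⟩, h3⟩
  simpa [weighted] using h2

theorem tsum_terminal (M : Simulation Γ asm mv I s₀) (P : Tile Γ.Glue → ℝ≥0)
    (g : Assembly Γ.Glue → ℝ≥0∞) :
    ∑' A : {A : Assembly Γ.Glue // Γ.Terminal A}, g A.1 * Γ.probTerm P A.1 =
      ∑' k, (avg (weighted P mv))^[k]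
        (fun s => stopped (weighted P mv) s * g (asm s)) s₀ := by
  refine (tsum_subtype {A | Γ.Terminal A} fun A => g A * Γ.probTerm P A).trans ?_
  have h1 : ∀ A, Set.indicator {A | Γ.Terminal A} (fun A => g A * Γ.probTerm P A) A =
      ∑' k, Γ.probAt P k A * (if Γ.Terminal A then g A else 0) := by
    intro A
    rw [ENNReal.tsum_mul_right, ← probTerm]
    by_cases hA : Γ.Terminal A
    · rw [Set.indicator_of_mem (by exact hA), if_pos hA, mul_comm]
    · rw [Set.indicator_of_notMem (by exact hA), if_neg hA, mul_zero]
  simp only [h1]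
  rw [ENNReal.tsum_comm]
  refine tsum_congr fun k => ?_
  have M' := M.producible_inv
  rw [M'.tsum_probAt P k]
  refine iterate_avg_congr (M'.inv_weighted P) k (fun s hs => ?_) s₀ M'.inv_start
  have h2 := M'.stuck_iff hs
  have h3 : weighted P mv s = [] ↔ mv s = [] := by simp [weighted]
  simp only [Function.comp_apply, Terminal, hs.2, true_and, h2, stopped, h3, ite_mul, one_mul,
    zero_mul]

theorem totalProb_eq_one (M : Simulation Γ asm mv I s₀)
    (D : Controlled (weighted P mv) I h size C) : Γ.totalProb P = 1 := by
  have h1 := M.tsum_terminal P fun _ => 1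
  simp only [one_mul, mul_one] at h1
  rw [totalProb, h1]
  exact D.tsum_stopped_one M.inv_start

theorem expectedLength_eq (M : Simulation Γ asm mv I s₀)
    (D : Controlled (weighted P mv) I h size C)
    (hlen : ∀ s, I s → mv s = [] → ((asm s).length : ℝ≥0) = h s) :
    Γ.expectedLength P = h s₀ := by
  rw [expectedLength, M.tsum_terminal P fun A => (A.length : ℝ≥0∞),
    ← D.tsum_stopped_harmonic M.inv_start]
  refine tsum_congr fun k => iterate_avg_congr D.inv k (fun s hs => ?_) s₀ M.inv_start
  by_cases h0 : mv s = []
  · rw [← hlen s hs h0]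
    rfl
  · have h3 : weighted P mv s ≠ [] := by simpa [weighted] using h0
    simp [stopped, h3]

end Simulation

end TileSystem

/-! ### The two kinds of blocks

A block is a rectangle of four rows that is assembled by tiles of its own; `true` stands for the
block of five columns that tosses a fair coin, `false` for a single column.  Glues are coded by
numbers: `0` is the null glue, `1` the glue of the entrance, `2` and `3` the glues of the two exits.
The states of the assembly of a block are numbered, too. -/

namespace Block

/-- The glue codes (north, east, south, west) of the tiles of the coin block. The tiles `0`–`14`
form a path that encloses the cells of the race between the tiles `15` and `16`. -/
def coinTiles : List (ℕ × ℕ × ℕ × ℕ) :=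
  [(10, 0, 0, 1), (11, 0, 10, 0), (12, 0, 11, 0), (0, 13, 12, 0), (0, 14, 0, 13), (0, 15, 0, 14),
    (0, 16, 0, 15), (0, 0, 17, 16), (17, 0, 9, 18), (0, 18, 0, 19), (0, 19, 0, 20),
    (0, 20, 21, 0), (21, 0, 22, 0), (22, 23, 0, 0), (4, 5, 0, 23), (0, 5, 4, 0), (4, 6, 7, 5),
    (9, 0, 8, 6), (7, 2, 0, 6), (8, 3, 0, 6)]

/-- The glue codes (north, east, south, west) of the tiles of the column block. -/
def columnTiles : List (ℕ × ℕ × ℕ × ℕ) :=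
  [(10, 2, 0, 1), (11, 0, 10, 0), (12, 0, 11, 0), (0, 0, 12, 0)]

/-- The glue code of the edge `d` of the tile number `t`. -/
def code (k : Bool) (t : ℕ) : Dir → ℕ
  | .north => ((bif k then coinTiles else columnTiles).getD t (0, 0, 0, 0)).1
  | .east => ((bif k then coinTiles else columnTiles).getD t (0, 0, 0, 0)).2.1
  | .south => ((bif k then coinTiles else columnTiles).getD t (0, 0, 0, 0)).2.2.1
  | .west => ((bif k then coinTiles else columnTiles).getD t (0, 0, 0, 0)).2.2.2

/-- The strength of a glue inside of a block. -/
def codeStr (g : ℕ) : ℕ :=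
  [0, 2, 0, 0, 2, 2, 1, 1, 1, 1].getD g 2

/-- The number of columns. -/
def cols (k : Bool) : ℕ := bif k then 5 else 1

/-- The number of tile types. -/
def types (k : Bool) : ℕ := bif k then 20 else 4

/-- The states are the numbers `1, …, states k - 1`. -/
def states (k : Bool) : ℕ := bif k then 30 else 5

/-- The order in which the cells of the coin block are filled; the cells `15`, …, `19` are filled
by the race. -/
def coinCells : List (List ℕ) :=
  [[0, 1, 2, 3], [13, 12, 11, 4], [14, 15, 10, 5], [16, 17, 9, 6], [19, 18, 8, 7]]

/-- The tiles at the cells `15`, …, `19` in the states `15`, …, `29`; `0` is an empty cell. -/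
def raceTiles : List (List ℕ) :=
  [[0, 0, 0, 0, 0], [15, 0, 0, 0, 0], [0, 16, 0, 0, 0], [15, 16, 0, 0, 0], [15, 0, 16, 0, 0],
    [15, 16, 16, 0, 0], [15, 0, 16, 17, 0], [15, 16, 16, 17, 0], [15, 16, 16, 17, 19],
    [0, 16, 15, 0, 0], [15, 16, 15, 0, 0], [0, 16, 15, 16, 0], [15, 16, 15, 16, 0],
    [0, 16, 15, 16, 18], [15, 16, 15, 16, 18]]

/-- The tile at the cell `(x, y)` in the state `c`. -/
def look (k : Bool) (c x y : ℕ) : Option ℕ :=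
  bif k then
    let n := (coinCells.getD x []).getD y 20
    if n < 15 then if n < c then some n else none
    else
      let t := (raceTiles.getD (c - 15) []).getD (n - 15) 0
      if t = 0 then none else some t
  else if x = 0 ∧ y < 4 ∧ y < c then some y else none

/-- The possible attachments in the race: the cell, the tile, and the new state. -/
def raceMoves : List (List ((ℕ × ℕ × ℕ) × ℕ)) :=
  [[((2, 1, 15), 16), ((3, 0, 16), 17)], [((3, 0, 16), 18), ((3, 1, 16), 19)],
    [((2, 1, 15), 18), ((3, 1, 15), 24)], [((3, 1, 16), 20), ((3, 1, 15), 25)],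
    [((3, 0, 16), 20), ((4, 1, 17), 21)], [((4, 1, 17), 22)], [((3, 0, 16), 22)],
    [((4, 0, 19), 23)], [], [((2, 1, 15), 25), ((4, 1, 16), 26)], [((4, 1, 16), 27)],
    [((2, 1, 15), 27), ((4, 0, 18), 28)], [((4, 0, 18), 29)], [((2, 1, 15), 29)], []]

/-- The cells of the path. -/
def path : List (ℕ × ℕ) :=
  [(0, 0), (0, 1), (0, 2), (0, 3), (1, 3), (2, 3), (3, 3), (4, 3), (4, 2), (3, 2), (2, 2), (1, 2),
    (1, 1), (1, 0), (2, 0)]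

/-- The possible attachments in the state `c`: the cell, the tile, and the new state. -/
def moves (k : Bool) (c : ℕ) : List ((ℕ × ℕ × ℕ) × ℕ) :=
  bif k then
    if c < 15 then [(((path.getD c (0, 0)).1, (path.getD c (0, 0)).2, c), c + 1)]
    else raceMoves.getD (c - 15) []
  else if c < 4 then [((0, c, c), c + 1)] else []

/-- The code of the open exit, or `0`. -/
def exit (k : Bool) (c : ℕ) : ℕ :=
  bif k then if c = 23 then 3 else if c = 28 ∨ c = 29 then 2 else 0 else 2

/-- The number of tiles. -/
def size (k : Bool) (c : ℕ) : ℕ :=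
  bif k then
    if c < 15 then c else [15, 16, 16, 17, 17, 18, 18, 19, 20, 17, 18, 18, 19, 19, 20].getD (c - 15) 0
  else c

/-- The contribution of the tile at `(x, y)` to the binding of the tile `t` that it touches along
the edge `d` of `t`. -/
def contrib (k : Bool) (c t : ℕ) (d : Dir) (x y : ℕ) : ℕ :=
  match look k c x y with
  | some t' => if code k t d = code k t' d.opp then codeStr (code k t d) else 0
  | none => 0

/-- The strength with which the tile `t` binds at `(x, y)` to the tiles of the block. -/
def binding (k : Bool) (c x y t : ℕ) : ℕ :=
  contrib k c t .north x (y + 1) + contrib k c t .east (x + 1) y +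
    (if y = 0 then 0 else contrib k c t .south x (y - 1)) +
    (if x = 0 then 0 else contrib k c t .west (x - 1) y)

set_option synthInstance.maxSize 100000 in
set_option synthInstance.maxHeartbeats 20000000 in
-- The second clause handles the only stray contact between blocks. A coin block may expose the
-- strength-1 glue 6 on its east side; a tile able to use it in the first column of the next block
-- gets no support from its own block, and so stays below temperature.
theorem moves_spec : ∀ k : Bool, ∀ c < states k, 0 < c → ∀ x < cols k, ∀ y < 4,
    look k c x y = none → ∀ t < types k,
      ((2 ≤ binding k c x y t ↔ ∃ m ∈ moves k c, m.1 = (x, y, t)) ∧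
        (x = 0 → code k t .west = 6 → binding k c x y t = 0)) := by
  decide +kernel

set_option synthInstance.maxSize 100000 in
set_option synthInstance.maxHeartbeats 20000000 in
theorem update_spec : ∀ k : Bool, ∀ c < states k, 0 < c → ∀ m ∈ moves k c,
    (0 < m.2 ∧ m.2 < states k ∧ m.1.1 < cols k ∧ m.1.2.1 < 4 ∧ m.1.2.2 < types k ∧
      look k c m.1.1 m.1.2.1 = none ∧ size k m.2 = size k c + 1 ∧
      (exit k c ≠ 0 → exit k m.2 = exit k c)) ∧
      ∀ x < cols k, ∀ y < 4,
        look k m.2 x y = if x = m.1.1 ∧ y = m.1.2.1 then some m.1.2.2 else look k c x y := by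
  decide +kernel

set_option synthInstance.maxSize 100000 in
set_option synthInstance.maxHeartbeats 20000000 in
-- Entrance and exit glues occur only on the west and east border, and on the border of a block
-- everything but the entrance and the open exit has strength at most one.
theorem look_spec : ∀ k : Bool, ∀ c < states k, 0 < c → ∀ x < cols k, ∀ y < 4,
    ∀ t ∈ (look k c x y).toList, t < types k ∧
      (x ≠ 0 → code k t .west ≠ 1 ∧ code k t .west ≠ 2 ∧ code k t .west ≠ 3) ∧
      (x + 1 ≠ cols k → code k t .east ≠ 1 ∧ code k t .east ≠ 2 ∧ code k t .east ≠ 3) ∧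
      (y = 0 → codeStr (code k t .south) ≤ 1) ∧
      (y = 3 → code k t .north = 0) ∧
      (x = 0 → code k t .west = if y = 0 then 1 else 0) ∧
      (x + 1 = cols k → y ≠ 0 → code k t .east = 0 ∨ code k t .east = 6) ∧
      (x + 1 = cols k → y = 0 → code k t .east = exit k c) := by
  decide +kernel

set_option synthInstance.maxSize 100000 in
set_option synthInstance.maxHeartbeats 20000000 in
theorem tile_spec : ∀ k : Bool, ∀ t < types k, code k t .east ≠ 1 ∧
    code k t .west ≠ 2 ∧ code k t .west ≠ 3 ∧ (code k t .west = 1 ↔ t = 0) ∧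
    (code k t .north ≠ 1 ∧ code k t .north ≠ 2 ∧ code k t .north ≠ 3) ∧
    (code k t .south ≠ 1 ∧ code k t .south ≠ 2 ∧ code k t .south ≠ 3) := by
  decide +kernel

set_option synthInstance.maxSize 100000 in
set_option synthInstance.maxHeartbeats 20000000 in
-- The clause on west glues separates tiles competing for one cell without requiring that the map
-- from tile numbers to tiles be injective. A block without moves is full and has an open exit, so
-- growth never gets stuck inside a block.
theorem state_spec : ∀ k : Bool, ∀ c < states k, 0 < c →
    look k c 0 0 = some 0 ∧ (look k c (cols k - 1) 0 = none ↔ exit k c = 0) ∧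
    0 < size k c ∧ size k c ≤ 4 * cols k ∧ (exit k c = 0 ∨ exit k c = 2 ∨ exit k c = 3) ∧
    ((moves k c).map Prod.fst).Nodup ∧
    (∀ m ∈ moves k c, ∀ m' ∈ moves k c, m.1.1 = m'.1.1 → m.1.2.1 = m'.1.2.1 →
      code k m.1.2.2 .west = code k m'.1.2.2 .west → m = m') ∧
    (moves k c = [] → exit k c ≠ 0 ∧ ∀ x < cols k, ∀ y < 4, look k c x y ≠ none) := by
  decide +kernel

theorem look_eq_none {k : Bool} {c x y : ℕ} (h : cols k ≤ x ∨ 4 ≤ y) : look k c x y = none := by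
  cases k with
  | false =>
    simp only [cols, look, cond_false] at h ⊢
    rw [if_neg]
    omega
  | true =>
    simp only [cols, look, cond_true] at h ⊢
    -- The default 20 is beyond the last cell 19: it is not a path cell, and its index 5 overruns
    -- the race rows, which have five entries, so it reads as empty.
    have : (coinCells.getD x []).getD y 20 = 20 := by
      rcases h with h | h
      · rw [List.getD_eq_default coinCells _ (by simpa [coinCells] using h)]
        rfl
      · have h' : ∀ l ∈ coinCells, l.length = 4 := by decide
        by_cases hx : x < coinCells.length
        · rw [List.getD_eq_getElem _ _ hx, List.getD_eq_default]
          rw [h' _ (List.getElem_mem hx)]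
          exact h
        · rw [List.getD_eq_default coinCells _ (by omega)]
          rfl
    rw [this]
    have h2 : (raceTiles.getD (c - 15) []).getD (20 - 15) 0 = 0 := by
      rw [List.getD_eq_default]
      by_cases hc : c - 15 < raceTiles.length
      · have h' : ∀ l ∈ raceTiles, l.length = 5 := by decide
        rw [List.getD_eq_getElem _ _ hc, h' _ (List.getElem_mem hc)]
      · rw [List.getD_eq_default raceTiles _ (by omega)]
        simp
    rw [h2]
    rfl

end Block

/-! ### Binding along a single edge -/

namespace Assembly

variable {G : Type} {str : G → ℕ} {α : Assembly G} {p : ℤ × ℤ} {t : Tile G}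

/-- The strength with which a tile at `p` would bind along its edge `d`. -/
def touch (str : G → ℕ) (α : Assembly G) (p : ℤ × ℤ) (t : Tile G) (d : Dir) : ℕ :=
  match α (p + d.vec) with
    | some b => if t.glue d = b.glue d.opp then str (t.glue d) else 0
    | none => 0

theorem binding_eq_touch (str : G → ℕ) (α : Assembly G) (p : ℤ × ℤ) (t : Tile G) :
    binding str α p t = touch str α p t .north + touch str α p t .east +
      touch str α p t .south + touch str α p t .west :=
  Dir.sum_univ _

theorem touch_none {d : Dir} {q : ℤ × ℤ} (hq : p + d.vec = q) (h : α q = none) :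
    touch str α p t d = 0 := by
  rw [touch, hq, h]

theorem touch_some {d : Dir} {q : ℤ × ℤ} (hq : p + d.vec = q) {b : Tile G} (h : α q = some b) :
    touch str α p t d = if t.glue d = b.glue d.opp then str (t.glue d) else 0 := by
  rw [touch, hq, h]

theorem touch_le {d : Dir} {q : ℤ × ℤ} (hq : p + d.vec = q) {b : Tile G} (h : α q = some b) :
    touch str α p t d ≤ str (b.glue d.opp) := by
  rw [touch_some hq h]
  split_ifs with h1
  · rw [h1]
  · exact Nat.zero_le _

end Assembly

/-! ### Lines of blocks

The blocks of a line have states `1, …, m + 1`, and `b i` is the kind of the blocks in the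
state `i`. The exit `2` of a block in the state `i + 1` leads to the state `i`, the exit `3` to the
state `m`; the state `0` is the end of the line. The line starts in the state `m + 1`. -/

namespace Line

open Block

/-- The glue with code `g` of the tiles of a block in the state `i`. -/
def glue (m i g : ℕ) : ℕ × ℕ :=
  if g = 2 then (i - 1, 1) else if g = 3 then (m, 1) else (i, g)

/-- The glue strengths. -/
def str (g : ℕ × ℕ) : ℕ := if g.1 = 0 then 0 else codeStr g.2

/-- The tile number `t` of a block in the state `i`. -/
def tile (b : ℕ → Bool) (m i t : ℕ) : Tile (ℕ × ℕ) := ⟨fun d => glue m i (code (b i) t d), default⟩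

/-- The number of columns of a list of blocks, given by their states and local states. -/
def width (b : ℕ → Bool) : List (ℕ × ℕ) → ℕ
  | [] => 0
  | x :: l => cols (b x.1) + width b l

/-- The assembly of a list of blocks, in the order from east to west. -/
def asm (b : ℕ → Bool) (m : ℕ) : List (ℕ × ℕ) → Assembly (ℕ × ℕ)
  | [] => fun _ => none
  | x :: l => fun p =>
    if (width b l : ℤ) ≤ p.1 then
      if 0 ≤ p.2 then
        (look (b x.1) x.2 (p.1 - width b l).toNat p.2.toNat).map (tile b m x.1)
      else none
    else asm b m l p

/-- The state to which the open exit of a block leads, or `0`. -/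
def next (b : ℕ → Bool) (m : ℕ) (x : ℕ × ℕ) : ℕ :=
  if exit (b x.1) x.2 = 0 then 0 else (glue m x.1 (exit (b x.1) x.2)).1

/-- The lists of blocks that occur. -/
structure Valid (b : ℕ → Bool) (m : ℕ) (l : List (ℕ × ℕ)) : Prop where
  ne_nil : l ≠ []
  block : ∀ x ∈ l, 0 < x.1 ∧ x.1 ≤ m + 1 ∧ 0 < x.2 ∧ x.2 < states (b x.1)
  chain : l.IsChain fun x y => next b m y = x.1
  first : ∀ x ∈ l.getLast?, x.1 = m + 1

variable {b : ℕ → Bool} {m : ℕ}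

theorem glue_of_ne {i g : ℕ} (h2 : g ≠ 2) (h3 : g ≠ 3) : glue m i g = (i, g) := by
  simp [glue, h2, h3]

/-- Inner glues carry the state of their block. Exits are recoded with second component 1, the code
of an entrance, so they cannot match an inner glue. -/
theorem glue_eq_iff {i j g g' : ℕ} (h : g' ≠ 1 ∧ g' ≠ 2 ∧ g' ≠ 3) :
    glue m j g = glue m i g' ↔ j = i ∧ g = g' := by
  obtain ⟨h1, h2, h3⟩ := h
  rw [glue_of_ne h2 h3, glue]
  split_ifs with h4 h5
  · simp [Ne.symm h1, h4, Ne.symm h2]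
  · simp [Ne.symm h1, h5, Ne.symm h3]
  · simp

theorem str_glue {i g : ℕ} (hi : 0 < i) (h2 : g ≠ 2) (h3 : g ≠ 3) :
    str (glue m i g) = codeStr g := by
  rw [glue_of_ne h2 h3, str, if_neg hi.ne']

theorem cols_pos (k : Bool) : 0 < cols k := by cases k <;> decide

theorem width_append (l l' : List (ℕ × ℕ)) : width b (l ++ l') = width b l + width b l' := by
  induction l with
  | nil => simp [width]
  | cons x l ih => simp only [List.cons_append, width, ih]; omega

theorem asm_cons (x : ℕ × ℕ) (l : List (ℕ × ℕ)) (p : ℤ × ℤ) : asm b m (x :: l) p =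
    if (width b l : ℤ) ≤ p.1 then
      if 0 ≤ p.2 then
        (look (b x.1) x.2 (p.1 - width b l).toNat p.2.toNat).map (tile b m x.1)
      else none
    else asm b m l p := rfl

theorem asm_snd_neg (l : List (ℕ × ℕ)) {p : ℤ × ℤ} (h : p.2 < 0) : asm b m l p = none := by
  induction l with
  | nil => rfl
  | cons x l ih => simp [asm_cons, ih, not_le.2 h]

theorem asm_snd_ge (l : List (ℕ × ℕ)) {p : ℤ × ℤ} (h : 4 ≤ p.2) : asm b m l p = none := by
  induction l with
  | nil => rfl
  | cons x l ih => rw [asm_cons, look_eq_none (Or.inr (by omega)), ih]; simp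

theorem asm_fst_neg (l : List (ℕ × ℕ)) {p : ℤ × ℤ} (h : p.1 < 0) : asm b m l p = none := by
  induction l with
  | nil => rfl
  | cons x l ih => rw [asm_cons, if_neg (by omega), ih]

theorem asm_fst_ge (l : List (ℕ × ℕ)) {p : ℤ × ℤ} (h : (width b l : ℤ) ≤ p.1) :
    asm b m l p = none := by
  cases l with
  | nil => rfl
  | cons x l =>
    rw [width] at h
    rw [asm_cons, look_eq_none (Or.inl (by omega)), if_pos (by omega)]
    simp

theorem asm_append (l l' : List (ℕ × ℕ)) (z : ℕ × ℕ) {x : ℕ} (hx : x < cols (b z.1)) (y : ℕ) :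
    asm b m (l ++ z :: l') ((width b l' : ℤ) + x, (y : ℤ)) =
      (look (b z.1) z.2 x y).map (tile b m z.1) := by
  induction l with
  | nil => simp [asm_cons]
  | cons w l ih =>
    rw [List.cons_append, asm_cons, if_neg, ih]
    rw [width_append, width]
    push_cast
    omega

theorem exists_block (l : List (ℕ × ℕ)) {n : ℕ} (h : n < width b l) :
    ∃ l₁ z l₂ x, l = l₁ ++ z :: l₂ ∧ x < cols (b z.1) ∧ n = width b l₂ + x := by
  induction l with
  | nil => simp [width] at h
  | cons w l ih =>
    by_cases hn : n < width b l
    · obtain ⟨l₁, z, l₂, x, rfl, hx, hn⟩ := ih hn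
      exact ⟨w :: l₁, z, l₂, x, rfl, hx, hn⟩
    · rw [width] at h
      exact ⟨[], w, l, n - width b l, rfl, by omega, by omega⟩

theorem Valid.next_left {l₁ l₂ : List (ℕ × ℕ)} {z w : ℕ × ℕ} (h : Valid b m (l₁ ++ w :: z :: l₂)) :
    next b m z = w.1 :=
  (List.isChain_cons_cons.1 (List.isChain_append.1 h.chain).2.1).1

/-- Across an edge interior to a block only tiles of the same state bind, with the strength read off
the table of the block. -/
theorem touch_own {A : Assembly (ℕ × ℕ)} {p q : ℤ × ℤ} {d : Dir} (hq : p + d.vec = q)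
    {i c x y : ℕ} (hA : A q = (look (b i) c x y).map (tile b m i)) (hi : 0 < i)
    (hc : ∀ t' ∈ look (b i) c x y, code (b i) t' d.opp ≠ 1 ∧ code (b i) t' d.opp ≠ 2 ∧
      code (b i) t' d.opp ≠ 3) (j t : ℕ) :
    A.touch str p (tile b m j t) d = if j = i then contrib (b i) c t d x y else 0 := by
  cases h : look (b i) c x y with
  | none =>
    rw [Assembly.touch_none hq (by rw [hA, h]; rfl), contrib, h]
    simp
  | some t' =>
    have h1 := hc t' h
    rw [Assembly.touch_some hq (b := tile b m i t') (by rw [hA, h]; rfl), contrib, h]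
    have h2 : (tile b m j t).glue d = (tile b m i t').glue d.opp ↔
      j = i ∧ code (b j) t d = code (b i) t' d.opp := glue_eq_iff h1
    by_cases hj : j = i
    · subst hj
      rw [if_pos rfl]
      by_cases h3 : code (b j) t d = code (b j) t' d.opp
      · rw [if_pos (h2.2 ⟨rfl, h3⟩)]
        simp only [tile, h3, if_true]
        exact str_glue hi h1.2.1 h1.2.2
      · rw [if_neg fun h4 => h3 (h2.1 h4).2]
        simp [h3]
    · rw [if_neg hj, if_neg fun h4 => hj (h2.1 h4).1]

/-- The binding strength at an empty cell of a block. -/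
theorem two_le_binding_iff {l₁ l₂ : List (ℕ × ℕ)} {z : ℕ × ℕ} (hl : Valid b m (l₁ ++ z :: l₂))
    {x y : ℕ} (hx : x < cols (b z.1)) (hy : y < 4) (h0 : look (b z.1) z.2 x y = none)
    {j t : ℕ} (ht : t < types (b j)) :
    2 ≤ (asm b m (l₁ ++ z :: l₂)).binding str ((width b l₂ : ℤ) + x, (y : ℤ)) (tile b m j t) ↔
      j = z.1 ∧ ∃ a ∈ moves (b z.1) z.2, a.1 = (x, y, t) := by
  obtain ⟨i, c⟩ := z
  have hz := hl.block (i, c) (by simp)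
  dsimp only at hz hx h0 ⊢
  set A := asm b m (l₁ ++ (i, c) :: l₂) with hA
  set p : ℤ × ℤ := ((width b l₂ : ℤ) + x, (y : ℤ)) with hp
  have look_lt : ∀ {x y t' : ℕ}, look (b i) c x y = some t' → x < cols (b i) ∧ y < 4 := by
    intro x y t' h
    by_contra hc
    rw [look_eq_none (by omega)] at h
    simp at h
  have spec : ∀ {x y t' : ℕ}, (h : look (b i) c x y = some t') → _ := fun {x y t'} h =>
    look_spec (b i) c hz.2.2.2 hz.2.2.1 x (look_lt h).1 y (look_lt h).2 t' (by simp [h])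
  have hst := state_spec (b i) c hz.2.2.2 hz.2.2.1
  have hN : A.touch str p (tile b m j t) .north =
      if j = i then contrib (b i) c t .north x (y + 1) else 0 := by
    refine touch_own (q := ((width b l₂ : ℤ) + x, ((y + 1 : ℕ) : ℤ))) ?_
      (asm_append _ _ _ hx _) hz.1 ?_ j t
    · simp [hp, Dir.vec]
    · intro t' h
      exact (tile_spec (b i) t' (spec h).1).2.2.2.2.2
  have hS : A.touch str p (tile b m j t) .south =
      if j = i then (if y = 0 then 0 else contrib (b i) c t .south x (y - 1)) else 0 := by
    rcases Nat.eq_zero_or_pos y with hy0 | hy0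
    · rw [if_pos hy0, ite_self]
      refine Assembly.touch_none rfl (asm_snd_neg _ ?_)
      simp [hp, hy0, Dir.vec]
    · rw [if_neg hy0.ne']
      refine touch_own (q := ((width b l₂ : ℤ) + x, ((y - 1 : ℕ) : ℤ))) ?_
        (asm_append _ _ _ hx _) hz.1 ?_ j t
      · simp [hp, Dir.vec, Nat.cast_sub hy0, sub_eq_add_neg]
      · intro t' h
        exact (tile_spec (b i) t' (spec h).1).2.2.2.2.1
  have hE : A.touch str p (tile b m j t) .east =
      if j = i then contrib (b i) c t .east (x + 1) y else 0 := by
    by_cases hx1 : x + 1 < cols (b i)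
    · refine touch_own (q := ((width b l₂ : ℤ) + (x + 1 : ℕ), (y : ℤ))) ?_
        (asm_append _ _ _ hx1 _) hz.1 ?_ j t
      · simp [hp, Dir.vec, add_assoc]
      · intro t' h
        exact (spec h).2.1 (by omega)
    · have e1 : contrib (b i) c t .east (x + 1) y = 0 := by
        rw [contrib, look_eq_none (Or.inl (by omega))]
      rw [e1, ite_self]
      have hx2 : cols (b i) = x + 1 := by omega
      rcases List.eq_nil_or_concat l₁ with rfl | ⟨l₁', w, rfl⟩
      · refine Assembly.touch_none rfl (asm_fst_ge _ ?_)
        simp [hp, Dir.vec, width, hx2]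
        omega
      · rw [List.concat_eq_append, List.append_assoc, List.singleton_append] at hl hA
        have hw := hl.block w (by simp)
        have hq : p + Dir.east.vec = ((width b ((i, c) :: l₂) : ℤ) + (0 : ℕ), (y : ℤ)) := by
          simp [hp, Dir.vec, width, hx2]
          ring
        -- The block `w` to the east has started, so the exit of this block is open and its
        -- southeast cell is already filled.
        have hy0 : y ≠ 0 := by
          rintro rfl
          have h1 := hl.next_left
          rw [next, if_pos] at h1
          · exact hw.1.ne h1
          · rw [← hst.2.1, hx2]
            exact h0
        have hAq := asm_append (b := b) (m := m) l₁' ((i, c) :: l₂) w (cols_pos _) y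
        rw [← hA] at hAq
        cases h : look (b w.1) w.2 0 y with
        | none => exact Assembly.touch_none hq (by rw [hAq, h]; rfl)
        | some t' =>
          have h1 := Assembly.touch_le (str := str) (α := A) (t := tile b m j t) hq
            (b := tile b m w.1 t') (by rw [hAq, h]; rfl)
          have h2 := (look_spec (b w.1) w.2 hw.2.2.2 hw.2.2.1 0 (cols_pos _) y hy t'
            (by simp [h])).2.2.2.2.2.1 rfl
          rw [if_neg hy0] at h2
          refine Nat.le_zero.1 (h1.trans ?_)
          simp only [tile, Dir.opp, h2]
          rw [str_glue hw.1 (by decide) (by decide)]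
          decide
  -- The error `e` is the possible contact with glue 6 of the block to the west.
  have hW : ∃ e, A.touch str p (tile b m j t) .west =
      (if j = i then (if x = 0 then 0 else contrib (b i) c t .west (x - 1) y) else 0) + e ∧
      e ≤ 1 ∧ (e ≠ 0 → x = 0 ∧ code (b j) t .west = 6) := by
    rcases Nat.eq_zero_or_pos x with hx0 | hx0
    · rw [if_pos hx0, ite_self]
      refine ⟨_, (zero_add _).symm, ?_⟩
      have hy0 : y ≠ 0 := by
        rintro rfl
        rw [hx0, hst.1] at h0
        simp at h0
      cases l₂ with
      | nil =>
        rw [Assembly.touch_none rfl (asm_fst_neg _ _)]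
        · simp
        · simp [hp, hx0, Dir.vec, width]
      | cons w l₂ =>
        have hw := hl.block w (by simp)
        have hq : p + Dir.west.vec = ((width b l₂ : ℤ) + (cols (b w.1) - 1 : ℕ), (y : ℤ)) := by
          have := cols_pos (b w.1)
          simp [hp, Dir.vec, width, hx0, Nat.cast_sub this]
          ring
        have hAq := asm_append (b := b) (m := m) (l₁ ++ [(i, c)]) l₂ w
          (Nat.sub_one_lt (cols_pos (b w.1)).ne') y
        rw [List.append_assoc, List.singleton_append, ← hA] at hAq
        cases h : look (b w.1) w.2 (cols (b w.1) - 1) y with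
        | none => rw [Assembly.touch_none hq (by rw [hAq, h]; rfl)]; simp
        | some t' =>
          have h1 := Assembly.touch_some (str := str) (α := A) (t := tile b m j t) hq
            (b := tile b m w.1 t') (by rw [hAq, h]; rfl)
          have h2 := (look_spec (b w.1) w.2 hw.2.2.2 hw.2.2.1 _
            (Nat.sub_one_lt (cols_pos (b w.1)).ne') y hy t' (by simp [h])).2.2.2.2.2.2.1
              (Nat.sub_add_cancel (cols_pos _)) hy0
          rw [h1]
          split_ifs with h3
          · rw [h3]
            rcases h2 with h2 | h2
            · simp only [tile, Dir.opp, h2]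
              rw [str_glue hw.1 (by decide) (by decide)]
              simp [codeStr]
            · refine ⟨?_, fun _ => ⟨hx0, ?_⟩⟩
              · simp only [tile, Dir.opp, h2]
                rw [str_glue hw.1 (by decide) (by decide)]
                decide
              · simp only [tile, Dir.opp, h2] at h3
                exact ((glue_eq_iff (by decide)).1 h3).2
          · simp
    · refine ⟨0, ?_, by simp, by simp⟩
      rw [if_neg hx0.ne', add_zero]
      refine touch_own (q := ((width b l₂ : ℤ) + (x - 1 : ℕ), (y : ℤ))) ?_
        (asm_append _ _ _ (by dsimp only; omega) _) hz.1 ?_ j t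
      · simp [hp, Dir.vec, Nat.cast_sub hx0]
        ring
      · intro t' h
        exact (spec h).2.2.1 (by have := (look_lt h).1; omega)
  obtain ⟨e, hW, he1, he2⟩ := hW
  rw [Assembly.binding_eq_touch, hN, hE, hS, hW]
  by_cases hj : j = i
  · subst hj
    simp only [if_true, true_and]
    have hm := moves_spec (b j) c hz.2.2.2 hz.2.2.1 x hx y hy h0 t ht
    rw [← hm.1]
    have hb : contrib (b j) c t .north x (y + 1) + contrib (b j) c t .east (x + 1) y +
      (if y = 0 then 0 else contrib (b j) c t .south x (y - 1)) +
      ((if x = 0 then 0 else contrib (b j) c t .west (x - 1) y) + e) =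
        Block.binding (b j) c x y t + e := by
      rw [Block.binding]
      omega
    rw [hb]
    -- If the stray bond is present, the tile has no other bond, so the total is at most one and no
    -- move exists either.
    by_cases he : e = 0
    · rw [he, add_zero]
    · have := hm.2 (he2 he).1 (he2 he).2
      omega
  · simp only [hj, if_false, false_and, iff_false]
    omega

theorem width_pos {l : List (ℕ × ℕ)} (h : l ≠ []) : 0 < width b l := by
  cases l with
  | nil => exact absurd rfl h
  | cons x l =>
    have := cols_pos (b x.1)
    rw [width]
    omega

theorem exists_of_asm_eq_some {l : List (ℕ × ℕ)} {q : ℤ × ℤ} {t : Tile (ℕ × ℕ)}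
    (h : asm b m l q = some t) : ∃ l₁ z l₂ x y t', l = l₁ ++ z :: l₂ ∧
      q = ((width b l₂ : ℤ) + (x : ℕ), ((y : ℕ) : ℤ)) ∧ x < cols (b z.1) ∧ y < 4 ∧
      look (b z.1) z.2 x y = some t' ∧ t = tile b m z.1 t' := by
  have h1 : 0 ≤ q.2 := by
    by_contra hc
    simp [asm_snd_neg l (not_le.1 hc)] at h
  have h2 : q.2 < 4 := by
    by_contra hc
    simp [asm_snd_ge l (not_lt.1 hc)] at h
  have h3 : 0 ≤ q.1 := by
    by_contra hc
    simp [asm_fst_neg l (not_le.1 hc)] at h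
  have h4 : q.1 < width b l := by
    by_contra hc
    simp [asm_fst_ge l (not_lt.1 hc)] at h
  obtain ⟨l₁, z, l₂, x, rfl, hx, hn⟩ := exists_block (b := b) l (n := q.1.toNat) (by omega)
  have hq : q = ((width b l₂ : ℤ) + (x : ℕ), ((q.2.toNat : ℕ) : ℤ)) := by
    ext <;> dsimp only <;> omega
  rw [hq, asm_append _ _ _ hx, Option.map_eq_some_iff] at h
  obtain ⟨t', h5, h6⟩ := h
  exact ⟨l₁, z, l₂, x, _, t', rfl, hq, hx, by omega, h5, h6.symm⟩

/-- The binding strength outside of the blocks. -/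
theorem two_le_binding_outside {l : List (ℕ × ℕ)} {z : ℕ × ℕ} (hl : Valid b m (z :: l))
    {p : ℤ × ℤ} (hp : ¬ (0 ≤ p.1 ∧ p.1 < width b (z :: l) ∧ 0 ≤ p.2 ∧ p.2 < 4))
    {j t : ℕ} (hj : 0 < j) (hjm : j ≤ m + 1) (ht : t < types (b j)) :
    2 ≤ (asm b m (z :: l)).binding str p (tile b m j t) ↔
      p = ((width b (z :: l) : ℤ), 0) ∧ j = next b m z ∧ t = 0 := by
  set A := asm b m (z :: l) with hA
  have key : ∀ d, A.touch str p (tile b m j t) d = 0 ∨ ∃ l₁ w l₂ x y t', z :: l = l₁ ++ w :: l₂ ∧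
      p + d.vec = ((width b l₂ : ℤ) + (x : ℕ), ((y : ℕ) : ℤ)) ∧ x < cols (b w.1) ∧ y < 4 ∧
      t' ∈ (look (b w.1) w.2 x y).toList ∧ (0 < w.1 ∧ w.2 < states (b w.1) ∧ 0 < w.2) ∧
      A.touch str p (tile b m j t) d = if glue m j (code (b j) t d) =
        glue m w.1 (code (b w.1) t' d.opp) then str (glue m w.1 (code (b w.1) t' d.opp)) else 0 := by
    intro d
    cases h : A (p + d.vec) with
    | none => exact Or.inl (Assembly.touch_none rfl h)
    | some t₁ =>
      obtain ⟨l₁, w, l₂, x, y, t', h1, h2, h3, h4, h5, rfl⟩ := exists_of_asm_eq_some h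
      have hw := hl.block w (by rw [h1]; simp)
      refine Or.inr ⟨l₁, w, l₂, x, y, t', h1, h2, h3, h4, by simp [h5],
        ⟨hw.1, hw.2.2.2, hw.2.2.1⟩, ?_⟩
      rw [Assembly.touch_some rfl h]
      by_cases h6 : glue m j (code (b j) t d) = glue m w.1 (code (b w.1) t' d.opp)
      · rw [if_pos (by exact h6), if_pos h6]
        exact congrArg str h6
      · rw [if_neg (by exact h6), if_neg h6]
  have hwidth : ∀ {l₁ l₂ : List (ℕ × ℕ)} {w : ℕ × ℕ}, z :: l = l₁ ++ w :: l₂ →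
      width b (z :: l) = width b l₁ + cols (b w.1) + width b l₂ := by
    intro l₁ l₂ w h
    rw [h, width_append, width, add_assoc]
  have hN : A.touch str p (tile b m j t) .north ≤ 1 ∧
      (A.touch str p (tile b m j t) .north ≠ 0 → p.2 < 0) := by
    rcases key .north with h | ⟨l₁, w, l₂, x, y, t', h1, h2, h3, h4, h5, h6, h7⟩
    · simp [h]
    · have h8 := hwidth h1
      simp only [Dir.vec, Prod.ext_iff, Prod.fst_add, Prod.snd_add] at h2
      have hy : y = 0 := by omega
      refine ⟨?_, fun _ => by omega⟩
      rw [h7]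
      have h9 := look_spec _ _ h6.2.1 h6.2.2 x h3 y h4 t' h5
      have h10 := tile_spec _ t' h9.1
      split_ifs
      · simp only [Dir.opp]
        rw [str_glue h6.1 h10.2.2.2.2.2.2.1 h10.2.2.2.2.2.2.2]
        exact h9.2.2.2.1 hy
      · exact Nat.zero_le _
  have hS : A.touch str p (tile b m j t) .south = 0 := by
    rcases key .south with h | ⟨l₁, w, l₂, x, y, t', h1, h2, h3, h4, h5, h6, h7⟩
    · exact h
    · have h8 := hwidth h1
      simp only [Dir.vec, Prod.ext_iff, Prod.fst_add, Prod.snd_add] at h2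
      have hy : y = 3 := by omega
      rw [h7]
      have h9 := look_spec _ _ h6.2.1 h6.2.2 x h3 y h4 t' h5
      simp only [Dir.opp, h9.2.2.2.2.1 hy]
      rw [str_glue h6.1 (by decide) (by decide)]
      simp [codeStr]
  have hE : A.touch str p (tile b m j t) .east = 0 := by
    rcases key .east with h | ⟨l₁, w, l₂, x, y, t', h1, h2, h3, h4, h5, h6, h7⟩
    · exact h
    · have h8 := hwidth h1
      simp only [Dir.vec, Prod.ext_iff, Prod.fst_add, Prod.snd_add] at h2
      have hx : x = 0 := by omega
      have hl₂ : l₂ = [] := by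
        by_contra hc
        have := width_pos (b := b) hc
        omega
      rw [h7]
      have h9 := look_spec _ _ h6.2.1 h6.2.2 x h3 y h4 t' h5
      have h10 := h9.2.2.2.2.2.1 hx
      -- No exit leads to state `m + 1`: exit 2 lowers the state and exit 3 leads to `m`. Hence
      -- nothing attaches to the west of the seed.
      have hw : w.1 = m + 1 := hl.first w (by rw [h1, hl₂]; simp)
      rw [hw] at h10
      simp only [Dir.opp, hw]
      by_cases hy : y = 0
      · rw [h10, if_pos hy, if_neg]
        rw [glue_of_ne (g := 1) (by decide) (by decide), glue]
        have := (tile_spec _ t ht).1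
        split_ifs <;> simp <;> omega
      · rw [h10, if_neg hy, str_glue (by omega) (by decide) (by decide)]
        simp [codeStr]
  have hW : (A.touch str p (tile b m j t) .west ≠ 0 → 0 ≤ p.2) ∧
      (2 ≤ A.touch str p (tile b m j t) .west ↔
        p = ((width b (z :: l) : ℤ), 0) ∧ j = next b m z ∧ t = 0) := by
    have hz := hl.block z (by simp)
    have hst := state_spec _ _ hz.2.2.2 hz.2.2.1
    rcases key .west with h | ⟨l₁, w, l₂, x, y, t', h1, h2, h3, h4, h5, h6, h7⟩
    · rw [h]
      simp only [ne_eq, not_true_eq_false, false_imp_iff, true_and]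
      refine iff_of_false (by decide) ?_
      rintro ⟨rfl, hj1, rfl⟩
      have hex : exit (b z.1) z.2 ≠ 0 := by
        intro hex
        rw [next, if_pos hex] at hj1
        omega
      have h1 : look (b z.1) z.2 (cols (b z.1) - 1) 0 ≠ none := fun hc => hex (hst.2.1.1 hc)
      obtain ⟨t', ht'⟩ := Option.ne_none_iff_exists'.1 h1
      have hc := cols_pos (b z.1)
      have h2 := asm_append (b := b) (m := m) [] l z (Nat.sub_one_lt hc.ne') 0
      rw [List.nil_append, ← hA, ht'] at h2
      rw [Assembly.touch_some (q := ((width b l : ℤ) + (cols (b z.1) - 1 : ℕ), ((0 : ℕ) : ℤ)))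
        (b := tile b m z.1 t') ?_ h2] at h
      · have h9 := (look_spec _ _ hz.2.2.2 hz.2.2.1 _ (Nat.sub_one_lt hc.ne') 0 (by decide) t'
          (by simp [ht'])).2.2.2.2.2.2.2 (Nat.sub_add_cancel hc) rfl
        have h10 := (tile_spec _ 0 ht).2.2.2.1.2 rfl
        have h11 : (next b m z, 1) = glue m z.1 (exit (b z.1) z.2) := by
          rw [next, if_neg hex]
          rcases hst.2.2.2.2.1 with h | h | h
          · exact absurd h hex
          · simp [h, glue]
          · simp [h, glue]
        simp only [tile, Dir.opp, h9, h10, ← h11, ← hj1] at h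
        rw [glue_of_ne (by decide) (by decide), if_pos rfl, str, if_neg hj.ne'] at h
        simp [codeStr] at h
      · simp [Dir.vec, width, Nat.cast_sub (Nat.succ_le_of_lt hc)]
        ring
    · have h8 := hwidth h1
      simp only [Dir.vec, Prod.ext_iff, Prod.fst_add, Prod.snd_add] at h2
      refine ⟨fun _ => by omega, ?_⟩
      have hx : x + 1 = cols (b w.1) ∧ width b l₁ = 0 := by omega
      have hl₁ : l₁ = [] := by
        by_contra hc
        have := width_pos (b := b) hc
        omega
      subst hl₁
      rw [List.nil_append, List.cons.injEq] at h1
      obtain ⟨rfl, rfl⟩ := h1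
      have h9 := look_spec _ _ h6.2.1 h6.2.2 x h3 y h4 t' h5
      have hp1 : p.1 = width b (z :: l) := by omega
      rw [h7]
      by_cases hy : y = 0
      · have h12 := h9.2.2.2.2.2.2.2 hx.1 hy
        have hex : exit (b z.1) z.2 ≠ 0 := by
          intro hex
          have hc := hst.2.1.2 hex
          rw [show cols (b z.1) - 1 = x by omega, ← hy] at hc
          simp [hc] at h5
        have h11 : (next b m z, 1) = glue m z.1 (exit (b z.1) z.2) := by
          rw [next, if_neg hex]
          rcases hst.2.2.2.2.1 with h | h | h
          · exact absurd h hex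
          · simp [h, glue]
          · simp [h, glue]
        have h13 := tile_spec _ t ht
        simp only [Dir.opp, h12, ← h11]
        rw [glue_of_ne h13.2.1 h13.2.2.1]
        have h15 : (j, code (b j) t .west) = (next b m z, 1) ↔ j = next b m z ∧ t = 0 := by
          rw [Prod.mk.injEq, h13.2.2.2.1]
        have hp2 : p = ((width b (z :: l) : ℤ), 0) := by
          ext
          · exact hp1
          · dsimp only; omega
        simp only [hp2, true_and]
        rw [← h15]
        split_ifs with h14
        · rw [str, if_neg (by rw [← (h15.1 h14).1]; exact hj.ne')]
          exact iff_of_true (show 2 ≤ codeStr 1 by decide) h14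
        · exact iff_of_false (by decide) h14
      · have h12 := h9.2.2.2.2.2.2.1 hx.1 hy
        refine iff_of_false ?_ ?_
        · have h13 : str (glue m z.1 (code (b z.1) t' Dir.west.opp)) ≤ 1 := by
            simp only [Dir.opp]
            rcases h12 with h12 | h12 <;> rw [h12, str_glue h6.1 (by decide) (by decide)] <;> decide
          split_ifs <;> omega
        · rintro ⟨h13, -⟩
          have : p.2 = 0 := by rw [h13]
          omega
  -- The remaining contacts cannot cooperate: the north edge binds only below the line, with
  -- strength at most one, the west edge only in rows at height zero or above.
  rw [Assembly.binding_eq_touch, hS, hE, ← hW.2]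
  omega

end Line

/-! ### The moves of a line of blocks, and the tile system that realises them -/

namespace Line

open Block

variable {b : ℕ → Bool} {m : ℕ}

/-- The attachments in the block `x` that starts at the column `o`. -/
def localMoves (b : ℕ → Bool) (m o : ℕ) (x : ℕ × ℕ) :
    List (((ℤ × ℤ) × Tile (ℕ × ℕ)) × (ℕ × ℕ)) :=
  (moves (b x.1) x.2).map fun a =>
    (((((o : ℤ) + (a.1.1 : ℕ), ((a.1.2.1 : ℕ) : ℤ)) : ℤ × ℤ), tile b m x.1 a.1.2.2), (x.1, a.2))

/-- The attachments inside of the blocks. -/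
def innerMoves (b : ℕ → Bool) (m : ℕ) :
    List (ℕ × ℕ) → List (((ℤ × ℤ) × Tile (ℕ × ℕ)) × List (ℕ × ℕ))
  | [] => []
  | x :: l => (localMoves b m (width b l) x).map (fun a => (a.1, a.2 :: l)) ++
      (innerMoves b m l).map fun a => (a.1, x :: a.2)

/-- The attachment that starts a new block. -/
def outerMoves (b : ℕ → Bool) (m : ℕ) :
    List (ℕ × ℕ) → List (((ℤ × ℤ) × Tile (ℕ × ℕ)) × List (ℕ × ℕ))
  | [] => []
  | x :: l => if next b m x = 0 then [] else
      [(((((width b (x :: l) : ℕ) : ℤ), 0), tile b m (next b m x) 0), (next b m x, 1) :: x :: l)]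

/-- All attachments. -/
def allMoves (b : ℕ → Bool) (m : ℕ) (l : List (ℕ × ℕ)) :
    List (((ℤ × ℤ) × Tile (ℕ × ℕ)) × List (ℕ × ℕ)) :=
  outerMoves b m l ++ innerMoves b m l

theorem mem_innerMoves {l : List (ℕ × ℕ)} {v : ((ℤ × ℤ) × Tile (ℕ × ℕ)) × List (ℕ × ℕ)} :
    v ∈ innerMoves b m l ↔ ∃ l₁ z l₂, l = l₁ ++ z :: l₂ ∧ ∃ a ∈ moves (b z.1) z.2,
      v = ((((width b l₂ : ℤ) + (a.1.1 : ℕ), ((a.1.2.1 : ℕ) : ℤ)), tile b m z.1 a.1.2.2),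
        l₁ ++ (z.1, a.2) :: l₂) := by
  induction l generalizing v with
  | nil => simp [innerMoves]
  | cons x l ih =>
    rw [innerMoves, List.mem_append, List.mem_map, List.mem_map]
    constructor
    · rintro (⟨a, ha, rfl⟩ | ⟨a, ha, rfl⟩)
      · obtain ⟨c, hc, rfl⟩ := List.mem_map.1 ha
        exact ⟨[], x, l, rfl, c, hc, rfl⟩
      · obtain ⟨l₁, z, l₂, rfl, c, hc, rfl⟩ := ih.1 ha
        exact ⟨x :: l₁, z, l₂, rfl, c, hc, rfl⟩
    · rintro ⟨l₁, z, l₂, h, c, hc, rfl⟩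
      cases l₁ with
      | nil =>
        rw [List.nil_append, List.cons.injEq] at h
        obtain ⟨rfl, rfl⟩ := h
        exact Or.inl ⟨_, List.mem_map.2 ⟨c, hc, rfl⟩, rfl⟩
      | cons w l₁ =>
        rw [List.cons_append, List.cons.injEq] at h
        obtain ⟨rfl, rfl⟩ := h
        exact Or.inr ⟨_, ih.2 ⟨l₁, z, l₂, rfl, c, hc, rfl⟩, rfl⟩

theorem mem_outerMoves {z : ℕ × ℕ} {l : List (ℕ × ℕ)}
    {v : ((ℤ × ℤ) × Tile (ℕ × ℕ)) × List (ℕ × ℕ)} :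
    v ∈ outerMoves b m (z :: l) ↔ next b m z ≠ 0 ∧
      v = (((((width b (z :: l) : ℕ) : ℤ), 0), tile b m (next b m z) 0),
        (next b m z, 1) :: z :: l) := by
  rw [outerMoves]
  split_ifs with h <;> simp [h]

theorem innerMoves_fst_lt {l : List (ℕ × ℕ)}
    (hl : ∀ x ∈ l, 0 < x.2 ∧ x.2 < states (b x.1)) : ∀ v ∈ innerMoves b m l,
    v.1.1.1 < width b l := by
  intro v hv
  obtain ⟨l₁, z, l₂, rfl, a, ha, rfl⟩ := mem_innerMoves.1 hv
  have hz := hl z (by simp)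
  have := (update_spec _ _ hz.2 hz.1 a ha).1.2.2.1
  simp only [width_append, width]
  omega

/-- Two moves at the same cell with equal tiles share the west glue, and by `state_spec` this
already identifies the moves. -/
theorem nodup_localMoves (o : ℕ) {x : ℕ × ℕ} (hx : 0 < x.2 ∧ x.2 < states (b x.1)) :
    ((localMoves b m o x).map Prod.fst).Nodup := by
  have hst := state_spec _ _ hx.2 hx.1
  rw [localMoves, List.map_map]
  refine (List.Nodup.of_map _ hst.2.2.2.2.2.1).map_on ?_
  intro a ha a' ha' h
  simp only [Function.comp_apply, Prod.mk.injEq, add_right_inj, Nat.cast_inj] at h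
  refine hst.2.2.2.2.2.2.1 a ha a' ha' h.1.1 h.1.2 ?_
  have h1 := (update_spec _ _ hx.2 hx.1 a ha).1.2.2.2.2.1
  have h2 := (update_spec _ _ hx.2 hx.1 a' ha').1.2.2.2.2.1
  have h3 := tile_spec _ _ h1
  have h4 := tile_spec _ _ h2
  have h5 := congrFun (congrArg Tile.glue h.2) .west
  simp only [tile] at h5
  rw [glue_of_ne h3.2.1 h3.2.2.1, glue_of_ne h4.2.1 h4.2.2.1] at h5
  exact (Prod.mk.inj h5).2

theorem nodup_innerMoves {l : List (ℕ × ℕ)} (hl : ∀ x ∈ l, 0 < x.2 ∧ x.2 < states (b x.1)) :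
    ((innerMoves b m l).map Prod.fst).Nodup := by
  induction l with
  | nil => simp [innerMoves]
  | cons x l ih =>
    have hl' : ∀ x ∈ l, 0 < x.2 ∧ x.2 < states (b x.1) := fun y hy => hl y (by simp [hy])
    rw [innerMoves, List.map_append, List.map_map, List.map_map]
    refine List.Nodup.append (nodup_localMoves _ (hl x (by simp))) (ih hl') ?_
    intro v h1 h2
    obtain ⟨a, ha, rfl⟩ := List.mem_map.1 h1
    obtain ⟨a', ha', h3⟩ := List.mem_map.1 h2
    obtain ⟨c, hc, rfl⟩ := List.mem_map.1 ha
    have h4 := innerMoves_fst_lt hl' a' ha'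
    simp only [Function.comp_apply] at h3
    rw [h3] at h4
    dsimp only at h4
    omega

theorem nodup_allMoves {l : List (ℕ × ℕ)} (hl : Valid b m l) :
    ((allMoves b m l).map Prod.fst).Nodup := by
  have hl' : ∀ x ∈ l, 0 < x.2 ∧ x.2 < states (b x.1) := fun y hy => (hl.block y hy).2.2
  rw [allMoves, List.map_append]
  refine List.Nodup.append ?_ (nodup_innerMoves hl') ?_
  · cases l with
    | nil => simp [outerMoves]
    | cons x l =>
      rw [outerMoves]
      split_ifs <;> simp
  · intro v h1 h2
    obtain ⟨a, ha, rfl⟩ := List.mem_map.1 h1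
    obtain ⟨a', ha', h3⟩ := List.mem_map.1 h2
    have h4 := innerMoves_fst_lt hl' a' ha'
    cases l with
    | nil => simp [outerMoves] at ha
    | cons x l =>
      rw [h3, (mem_outerMoves.1 ha).2] at h4
      exact lt_irrefl _ h4

theorem asm_update (l₁ : List (ℕ × ℕ)) {z : ℕ × ℕ} (l₂ : List (ℕ × ℕ)) {c x y t : ℕ}
    (hx : x < cols (b z.1))
    (h : ∀ x' < cols (b z.1), ∀ y' < 4, look (b z.1) c x' y' =
      if x' = x ∧ y' = y then some t else look (b z.1) z.2 x' y') (hy : y < 4) :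
    asm b m (l₁ ++ (z.1, c) :: l₂) = (asm b m (l₁ ++ z :: l₂)).add
      ((width b l₂ : ℤ) + (x : ℕ), ((y : ℕ) : ℤ)) (tile b m z.1 t) := by
  funext p
  rw [Assembly.add]
  by_cases hp : p = ((width b l₂ : ℤ) + (x : ℕ), ((y : ℕ) : ℤ))
  · rw [hp, Function.update_self]
    have := asm_append (b := b) (m := m) l₁ l₂ (z.1, c) hx y
    rw [this, h x hx y hy, if_pos ⟨rfl, rfl⟩]
    rfl
  · rw [Function.update_of_ne hp]
    induction l₁ with
    | nil =>
      simp only [List.nil_append, asm_cons]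
      by_cases h1 : (width b l₂ : ℤ) ≤ p.1
      · by_cases h2 : 0 ≤ p.2
        · rw [if_pos h1, if_pos h1, if_pos h2, if_pos h2]
          congr 1
          by_cases h3 : (p.1 - width b l₂).toNat < cols (b z.1) ∧ p.2.toNat < 4
          · rw [h _ h3.1 _ h3.2, if_neg]
            rintro ⟨h4, h5⟩
            apply hp
            ext <;> dsimp only <;> omega
          · rw [look_eq_none (by omega), look_eq_none (by omega)]
        · rw [if_neg h2, if_neg h2]
      · rw [if_neg h1, if_neg h1]
    | cons w l₁ ih =>
      have hw : width b (l₁ ++ (z.1, c) :: l₂) = width b (l₁ ++ z :: l₂) := by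
        simp only [width_append, width]
      simp only [List.cons_append, asm_cons, hw, ih]

theorem look_first {k : Bool} (x y : ℕ) :
    look k 1 x y = if x = 0 ∧ y = 0 then some 0 else none := by
  by_cases h : x < cols k ∧ y < 4
  · have h1 : ∀ k : Bool, ∀ x < cols k, ∀ y < 4,
        look k 1 x y = if x = 0 ∧ y = 0 then some 0 else none := by decide
    exact h1 k x h.1 y h.2
  · have := cols_pos k
    rw [look_eq_none (by omega), if_neg (by omega)]

theorem asm_new (l : List (ℕ × ℕ)) (i : ℕ) :
    asm b m ((i, 1) :: l) = (asm b m l).add ((width b l : ℕ), 0) (tile b m i 0) := by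
  funext p
  rw [Assembly.add, asm_cons]
  by_cases hp : p = ((width b l : ℤ), 0)
  · rw [hp, Function.update_self, if_pos le_rfl, if_pos le_rfl, look_first]
    simp
  · rw [Function.update_of_ne hp]
    by_cases h1 : (width b l : ℤ) ≤ p.1
    · rw [if_pos h1, asm_fst_ge l h1]
      by_cases h2 : 0 ≤ p.2
      · rw [if_pos h2, look_first, if_neg]
        · rfl
        rintro ⟨h4, h5⟩
        apply hp
        ext <;> dsimp only <;> omega
      · rw [if_neg h2]
    · rw [if_neg h1]

/-- An exit stays as it is once open. Any block with a successor has an open exit, so its later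
internal growth does not disturb the chain of states. -/
theorem Valid.move {l₁ l₂ : List (ℕ × ℕ)} {z : ℕ × ℕ} (h : Valid b m (l₁ ++ z :: l₂)) {c : ℕ}
    (hc : 0 < c ∧ c < states (b z.1))
    (hex : exit (b z.1) z.2 ≠ 0 → exit (b z.1) c = exit (b z.1) z.2) :
    Valid b m (l₁ ++ (z.1, c) :: l₂) where
  ne_nil := by simp
  block x hx := by
    rw [List.mem_append, List.mem_cons] at hx
    rcases hx with hx | rfl | hx
    · exact h.block x (by simp [hx])
    · have := h.block z (by simp)
      exact ⟨this.1, this.2.1, hc⟩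
    · exact h.block x (by simp [hx])
  chain := by
    have h1 := List.isChain_append.1 h.chain
    refine List.isChain_append.2 ⟨h1.1, ?_, ?_⟩
    · have h2 := List.isChain_cons.1 h1.2.1
      exact List.isChain_cons.2 ⟨h2.1, h2.2⟩
    · intro x hx y hy
      have h2 := h1.2.2 x hx z (by simp)
      simp only [List.head?_cons, Option.mem_some_iff] at hy
      subst hy
      have h3 := h.block x (by simp [List.mem_of_mem_getLast? hx])
      have h4 : exit (b z.1) z.2 ≠ 0 := by
        intro h4
        rw [next, if_pos h4] at h2
        omega
      rw [← h2]
      simp only [next, hex h4]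
  first x hx := by
    cases l₂ with
    | nil =>
      simp only [List.getLast?_append, List.getLast?_singleton, Option.some_or,
        Option.mem_some_iff] at hx
      subst hx
      exact h.first z (by simp)
    | cons w l₂ =>
      refine h.first x ?_
      simpa only [List.getLast?_append, List.getLast?_cons_cons] using hx

theorem Valid.new {z : ℕ × ℕ} {l : List (ℕ × ℕ)} (h : Valid b m (z :: l)) (h0 : next b m z ≠ 0) :
    Valid b m ((next b m z, 1) :: z :: l) where
  ne_nil := by simp
  block x hx := by
    rw [List.mem_cons] at hx
    rcases hx with rfl | hx
    · refine ⟨Nat.pos_of_ne_zero h0, ?_, Nat.one_pos, ?_⟩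
      · have hz := h.block z (by simp)
        have hst := state_spec _ _ hz.2.2.2 hz.2.2.1
        dsimp only
        rw [next]
        rcases hst.2.2.2.2.1 with h1 | h1 | h1 <;> simp [h1, glue]
        omega
      · dsimp only
        cases b (next b m z) <;> decide
    · exact h.block x hx
  chain := List.isChain_cons_cons.2 ⟨rfl, h.chain⟩
  first x hx := h.first x (by rwa [List.getLast?_cons_cons] at hx)

theorem asm_dom_nonempty {l : List (ℕ × ℕ)} (hl : Valid b m l) : (asm b m l).dom.Nonempty := by
  cases l with
  | nil => exact absurd rfl hl.ne_nil
  | cons z l =>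
    have hz := hl.block z (by simp)
    refine ⟨((width b l : ℤ) + (0 : ℕ), ((0 : ℕ) : ℤ)), ?_⟩
    have := asm_append (b := b) (m := m) [] l z (cols_pos _) 0
    rw [List.nil_append, (state_spec _ _ hz.2.2.2 hz.2.2.1).1] at this
    intro h
    rw [this] at h
    simp at h

theorem asm_seed (i : ℕ) (p : ℤ × ℤ) :
    asm b m [(i, 1)] p = if p = (0, 0) then some (tile b m i 0) else none := by
  rw [asm_new, Assembly.add]
  by_cases h : p = (0, 0)
  · rw [if_pos h, h]
    exact Function.update_self ..
  · rw [if_neg h]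
    exact Function.update_of_ne h ..

theorem seed_dom (i : ℕ) : (asm b m [(i, 1)]).dom = {(0, 0)} := by
  ext p
  rw [Assembly.dom, Set.mem_ofPred_eq, asm_seed]
  by_cases h : p = (0, 0) <;> simp [h]

/-- The tile system whose blocks have the kinds `b 1`, …, `b (m + 1)`. -/
def system (b : ℕ → Bool) (m : ℕ) : TileSystem where
  Glue := ℕ × ℕ
  str := str
  tiles := (Finset.Icc 1 (m + 1)).biUnion fun i =>
    (Finset.range (types (b i))).image (tile b m i)
  seed := asm b m [(m + 1, 1)]
  temp := 2
  temp_pos := two_pos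
  seed_finite := by rw [seed_dom]; exact Set.finite_singleton _
  seed_nonempty := by rw [seed_dom]; exact Set.singleton_nonempty _
  seed_tiles p t h := by
    rw [asm_seed] at h
    split_ifs at h with hp
    obtain rfl := Option.some.inj h
    refine Finset.mem_biUnion.2 ⟨m + 1, Finset.mem_Icc.2 ⟨by omega, le_rfl⟩,
      Finset.mem_image_of_mem _ (Finset.mem_range.2 ?_)⟩
    cases b (m + 1) <;> decide
  seed_stable S hS hSd := by
    rw [seed_dom] at hSd
    rw [Set.ssubset_singleton_iff, Finset.coe_eq_empty] at hSd
    exact absurd hSd hS.ne_empty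

theorem mem_tiles {t : Tile (ℕ × ℕ)} : t ∈ (system b m).tiles ↔
    ∃ j, 0 < j ∧ j ≤ m + 1 ∧ ∃ t' < types (b j), t = tile b m j t' := by
  refine Finset.mem_biUnion.trans ?_
  simp only [Finset.mem_Icc, Finset.mem_image, Finset.mem_range]
  constructor
  · rintro ⟨j, hj, t', ht', rfl⟩
    exact ⟨j, hj.1, hj.2, t', ht', rfl⟩
  · rintro ⟨j, hj, hj', t', ht', rfl⟩
    exact ⟨j, ⟨hj, hj'⟩, t', ht', rfl⟩

theorem card_tiles_le (b : ℕ → Bool) (m : ℕ) : (system b m).tiles.card ≤ 20 * (m + 1) := by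
  refine Finset.card_biUnion_le.trans ?_
  refine (Finset.sum_le_card_nsmul _ _ 20 fun i _ => ?_).trans ?_
  · refine Finset.card_image_le.trans ?_
    rw [Finset.card_range]
    cases b i <;> decide
  · simp [mul_comm]

theorem attachable_iff {l : List (ℕ × ℕ)} (hl : Valid b m l) (p : ℤ × ℤ) (t : Tile (ℕ × ℕ)) :
    (t ∈ (system b m).tiles ∧ asm b m l p = none ∧ 2 ≤ (asm b m l).binding str p t) ↔
      ∃ l', ((p, t), l') ∈ allMoves b m l := by
  obtain ⟨z, l, rfl⟩ := List.exists_cons_of_ne_nil hl.ne_nil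
  have hz := hl.block z (by simp)
  have htypes : ∀ k : Bool, 0 < types k := by decide
  simp only [allMoves, List.mem_append, exists_or]
  by_cases hp : 0 ≤ p.1 ∧ p.1 < width b (z :: l) ∧ 0 ≤ p.2 ∧ p.2 < 4
  · have hout : ¬ ∃ l', ((p, t), l') ∈ outerMoves b m (z :: l) := by
      rintro ⟨l', h⟩
      have h1 := congrArg (fun v => v.1.1.1) (mem_outerMoves.1 h).2
      dsimp only at h1
      omega
    rw [or_iff_right hout]
    constructor
    · obtain ⟨l₁, w, l₂, x, hw, hx, hn⟩ :=
        exists_block (b := b) (z :: l) (n := p.1.toNat) (by omega)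
      have hq : p = ((width b l₂ : ℤ) + (x : ℕ), ((p.2.toNat : ℕ) : ℤ)) := by
        ext <;> dsimp only <;> omega
      have hy : p.2.toNat < 4 := by omega
      generalize p.2.toNat = y at hq hy
      subst hq
      rw [hw] at hl ⊢
      rw [asm_append _ _ _ hx, Option.map_eq_none_iff]
      rintro ⟨ht, h0, h2⟩
      obtain ⟨j, hj, hjm, t', ht', rfl⟩ := mem_tiles.1 ht
      obtain ⟨rfl, a, ha, ha'⟩ := (two_le_binding_iff hl hx hy h0 ht').1 h2
      refine ⟨l₁ ++ (w.1, a.2) :: l₂, mem_innerMoves.2 ⟨l₁, w, l₂, rfl, a, ha, ?_⟩⟩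
      rw [ha']
    · rintro ⟨l', h⟩
      obtain ⟨l₁, w, l₂, hw, a, ha, ha'⟩ := mem_innerMoves.1 h
      simp only [Prod.mk.injEq] at ha'
      obtain ⟨⟨rfl, rfl⟩, -⟩ := ha'
      rw [hw] at hl ⊢
      have hwb := hl.block w (by simp)
      have h1 := (update_spec _ _ hwb.2.2.2 hwb.2.2.1 a ha).1
      rw [asm_append _ _ _ h1.2.2.1, h1.2.2.2.2.2.1]
      refine ⟨mem_tiles.2 ⟨_, hwb.1, hwb.2.1, _, h1.2.2.2.2.1, rfl⟩, rfl, ?_⟩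
      exact (two_le_binding_iff hl h1.2.2.1 h1.2.2.2.1 h1.2.2.2.2.2.1 h1.2.2.2.2.1).2
        ⟨rfl, a, ha, rfl⟩
  · have hin : ¬ ∃ l', ((p, t), l') ∈ innerMoves b m (z :: l) := by
      rintro ⟨l', h⟩
      obtain ⟨l₁, w, l₂, hw, a, ha, ha'⟩ := mem_innerMoves.1 h
      have hwb := hl.block w (by rw [hw]; simp)
      have h1 := (update_spec _ _ hwb.2.2.2 hwb.2.2.1 a ha).1
      apply hp
      rw [hw, width_append, width]
      simp only [Prod.mk.injEq] at ha'
      rw [ha'.1.1]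
      dsimp only
      omega
    rw [or_iff_left hin]
    constructor
    · rintro ⟨ht, h0, h2⟩
      obtain ⟨j, hj, hjm, t', ht', rfl⟩ := mem_tiles.1 ht
      obtain ⟨rfl, rfl, rfl⟩ := (two_le_binding_outside hl hp hj hjm ht').1 h2
      exact ⟨_, mem_outerMoves.2 ⟨hj.ne', rfl⟩⟩
    · rintro ⟨l', h⟩
      obtain ⟨h0, h1⟩ := mem_outerMoves.1 h
      simp only [Prod.mk.injEq] at h1
      obtain ⟨⟨rfl, rfl⟩, -⟩ := h1
      have h2 := (hl.new h0).block _ (List.mem_cons_self ..)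
      refine ⟨mem_tiles.2 ⟨_, h2.1, h2.2.1, 0, htypes _, rfl⟩, asm_fst_ge _ le_rfl, ?_⟩
      exact (two_le_binding_outside hl hp h2.1 h2.2.1 (htypes _)).2 ⟨rfl, rfl, rfl⟩

theorem step_allMoves {l : List (ℕ × ℕ)} (hl : Valid b m l) :
    ∀ v ∈ allMoves b m l, asm b m v.2 = (asm b m l).add v.1.1 v.1.2 ∧ Valid b m v.2 := by
  intro v hv
  rcases List.mem_append.1 hv with hv | hv
  · obtain ⟨z, l, rfl⟩ := List.exists_cons_of_ne_nil hl.ne_nil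
    obtain ⟨h0, rfl⟩ := mem_outerMoves.1 hv
    exact ⟨asm_new _ _, hl.new h0⟩
  · obtain ⟨l₁, z, l₂, rfl, a, ha, rfl⟩ := mem_innerMoves.1 hv
    have hz := hl.block z (by simp)
    have h1 := update_spec _ _ hz.2.2.2 hz.2.2.1 a ha
    exact ⟨asm_update _ _ h1.1.2.2.1 h1.2 h1.1.2.2.2.1,
      hl.move ⟨h1.1.1, h1.1.2.1⟩ h1.1.2.2.2.2.2.2.2⟩

/-- The tile system assembles lines of blocks. -/
theorem simulation (b : ℕ → Bool) (m : ℕ) :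
    TileSystem.Simulation (system b m) (asm b m) (allMoves b m)
      (fun l => Valid b m l ∧ (asm b m l).Stable str 2) [(m + 1, 1)] :=
  TileSystem.Simulation.of_binding rfl
    ⟨by simp, by
      simp only [List.mem_singleton, forall_eq]
      refine ⟨by omega, le_rfl, Nat.one_pos, ?_⟩
      cases b (m + 1) <;> decide, by simp, by simp⟩
    (fun _ hl => asm_dom_nonempty hl) (fun _ hl => attachable_iff hl)
    (fun _ hl => nodup_allMoves hl) fun _ hl => step_allMoves hl

/-- A line without attachments is complete. -/
theorem complete_of_allMoves_eq_nil {z : ℕ × ℕ} {l : List (ℕ × ℕ)} (hl : Valid b m (z :: l))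
    (h : allMoves b m (z :: l) = []) : next b m z = 0 ∧ exit (b z.1) z.2 ≠ 0 ∧
      (asm b m (z :: l)).dom = Set.Ico 0 (width b (z :: l) : ℤ) ×ˢ Set.Ico 0 4 := by
  obtain ⟨h1, h2⟩ := List.append_eq_nil_iff.1 h
  have h3 : ∀ l₁ w l₂, z :: l = l₁ ++ w :: l₂ → exit (b w.1) w.2 ≠ 0 ∧
      ∀ x < cols (b w.1), ∀ y < 4, look (b w.1) w.2 x y ≠ none := by
    intro l₁ w l₂ hw
    have hwb := hl.block w (by rw [hw]; simp)
    refine (state_spec _ _ hwb.2.2.2 hwb.2.2.1).2.2.2.2.2.2.2 ?_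
    rw [List.eq_nil_iff_forall_not_mem]
    intro a ha
    have := mem_innerMoves (b := b) (m := m) (l := z :: l).2 ⟨l₁, w, l₂, hw, a, ha, rfl⟩
    rw [h2] at this
    exact absurd this List.not_mem_nil
  refine ⟨?_, (h3 [] z l rfl).1, ?_⟩
  · by_contra hc
    have := mem_outerMoves (b := b) (m := m) (l := l).2 ⟨hc, rfl⟩
    rw [h1] at this
    exact absurd this List.not_mem_nil
  · ext p
    simp only [Set.mem_prod, Set.mem_Ico]
    constructor
    · intro hp
      obtain ⟨t, ht⟩ := Option.ne_none_iff_exists'.1 hp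
      obtain ⟨l₁, w, l₂, x, y, t', hw, rfl, hx, hy, -, -⟩ := exists_of_asm_eq_some ht
      rw [hw, width_append, width]
      dsimp only
      omega
    · rintro ⟨⟨ha, hb⟩, hc, hd⟩
      obtain ⟨l₁, w, l₂, x, hw, hx, hn⟩ :=
        exists_block (b := b) (z :: l) (n := p.1.toNat) (by omega)
      have hq : p = ((width b l₂ : ℤ) + (x : ℕ), ((p.2.toNat : ℕ) : ℤ)) := by
        ext <;> dsimp only <;> omega
      change asm b m (z :: l) p ≠ none
      rw [hq, hw, asm_append _ _ _ hx, ne_eq, Option.map_eq_none_iff]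
      exact (h3 l₁ w l₂ hw).2 x hx _ (by omega)

theorem length_of_dom {A : Assembly (ℕ × ℕ)} {n : ℕ}
    (h : A.dom = Set.Ico 0 (n : ℤ) ×ˢ Set.Ico 0 4) : A.length = n := by
  rw [Assembly.length, h, Set.fst_image_prod _ ⟨0, by simp⟩]
  simp [Set.ncard_eq_toFinset_card']

end Line

/-! ### Fairness of the coin and the harmonic function -/

namespace Block

/-- The probability that the coin block in the state `c` will open the exit `3`, if the tiles
`15` and `16` have the concentrations `u` and `v`. -/
def exitThree (u v : ℝ≥0) (c : ℕ) : ℝ≥0 :=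
  if c ≤ 15 then 1 / 2 else if c = 16 then (u + 2 * v) / (2 * (u + v)) else
    if c = 17 then v / (2 * (u + v)) else if c = 18 then v / (u + v) else if c ≤ 23 then 1 else 0

/-- The probability that the coin block in the state `c` will open the exit `2`. -/
def exitTwo (u v : ℝ≥0) (c : ℕ) : ℝ≥0 :=
  if c ≤ 15 then 1 / 2 else if c = 16 then u / (2 * (u + v)) else
    if c = 17 then (2 * u + v) / (2 * (u + v)) else if c = 18 then u / (u + v) else
      if c ≤ 23 then 0 else 1

theorem exit_le_one (u v : ℝ≥0) (c : ℕ) : exitThree u v c ≤ 1 ∧ exitTwo u v c ≤ 1 := by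
  rw [exitThree, exitTwo]
  split_ifs
  all_goals
    constructor
  all_goals try exact le_rfl
  all_goals try exact zero_le_one
  all_goals
    refine NNReal.div_le_of_le_mul ?_
    rw [← NNReal.coe_le_coe]
    push_cast
    linarith [u.2, v.2]

/-- This is the fairness of the coin. The exit probabilities are harmonic for arbitrary weights; in
state 15 the identity is `u(u + 2v) + v * v = (u + v)^2` up to the factor `1 / (2(u + v))`. -/
theorem sum_moves_exit {w : ℕ → ℝ≥0} (hu : 0 < w 15) (A B : ℝ≥0) {c : ℕ}
    (hc : c < states true) (h0 : 0 < c) :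
    ((moves true c).map fun a => w a.1.2.2 *
      (5 + exitThree (w 15) (w 16) a.2 * A + exitTwo (w 15) (w 16) a.2 * B)).sum =
    ((moves true c).map fun a => w a.1.2.2).sum *
      (5 + exitThree (w 15) (w 16) c * A + exitTwo (w 15) (w 16) c * B) := by
  have huv : w 15 + w 16 ≠ 0 := (add_pos_of_pos_of_nonneg hu bot_le).ne'
  simp only [states, cond_true] at hc
  interval_cases c <;> simp [moves, path, raceMoves, exitThree, exitTwo]
  all_goals try field_simp
  all_goals try ring

end Block

namespace TileSystem

variable {Γ : TileSystem} {P Q : Tile Γ.Glue → ℝ≥0}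

/-- This permits replacing a concentration by a function that is positive on all tiles. -/
theorem probTerm_congr (h : ∀ t ∈ Γ.tiles, P t = Q t) : Γ.probTerm P = Γ.probTerm Q := by
  have h1 : Γ.trans P = Γ.trans Q := by
    have h2 : Γ.weight P = Γ.weight Q := by
      funext A B
      exact Finset.sum_congr rfl fun t ht => by rw [h t ht]
    funext A B
    rw [trans, trans, h2]
  have h3 : ∀ k, Γ.probAt P k = Γ.probAt Q k := by
    intro k
    induction k with
    | zero => rfl
    | succ k ih =>
      funext B
      rw [probAt, probAt, ih, h1]
  funext A
  simp only [probTerm, h3]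

theorem totalProb_congr (h : ∀ t ∈ Γ.tiles, P t = Q t) : Γ.totalProb P = Γ.totalProb Q := by
  rw [totalProb, totalProb, probTerm_congr h]

theorem expectedLength_congr (h : ∀ t ∈ Γ.tiles, P t = Q t) :
    Γ.expectedLength P = Γ.expectedLength Q := by
  rw [expectedLength, expectedLength, probTerm_congr h]

end TileSystem

namespace Line

open Block

variable {b : ℕ → Bool} {m : ℕ}

/-- `E i` is the expected number of columns that are assembled from the state `i` on. -/
structure IsExpectation (b : ℕ → Bool) (m : ℕ) (E : ℕ → ℝ≥0) : Prop where
  zero : E 0 = 0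
  column : ∀ i ≤ m, b (i + 1) = false → E (i + 1) = 1 + E i
  coin : ∀ i ≤ m, b (i + 1) = true → E (i + 1) = 5 + E m / 2 + E i / 2

/-- The expected number of columns that are assembled from the start of the block `x` on. -/
def value (b : ℕ → Bool) (m : ℕ) (E : ℕ → ℝ≥0) (P : Tile (ℕ × ℕ) → ℝ≥0) (x : ℕ × ℕ) : ℝ≥0 :=
  bif b x.1 then
    5 + exitThree (P (tile b m x.1 15)) (P (tile b m x.1 16)) x.2 * E m +
      exitTwo (P (tile b m x.1 15)) (P (tile b m x.1 16)) x.2 * E (x.1 - 1)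
  else 1 + E (x.1 - 1)

/-- The expected final number of columns. -/
def mean (b : ℕ → Bool) (m : ℕ) (E : ℕ → ℝ≥0) (P : Tile (ℕ × ℕ) → ℝ≥0) :
    List (ℕ × ℕ) → ℝ≥0
  | [] => 0
  | x :: l => width b l + value b m E P x

/-- The number of tiles. -/
def size (b : ℕ → Bool) (l : List (ℕ × ℕ)) : ℕ := (l.map fun x => Block.size (b x.1) x.2).sum

variable {E : ℕ → ℝ≥0} {P : Tile (ℕ × ℕ) → ℝ≥0}

theorem value_first (hE : IsExpectation b m E) {i : ℕ} (hi : 0 < i) (him : i ≤ m + 1) :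
    value b m E P (i, 1) = E i := by
  obtain ⟨i, rfl⟩ := Nat.exists_eq_add_one.2 hi
  cases h : b (i + 1) with
  | false => simp [value, h, hE.column i (by omega) h]
  | true =>
    rw [hE.coin i (by omega) h]
    simp [value, h, exitThree, exitTwo]
    ring

/-- With an open exit the coin has been decided: one exit probability is 1, the other 0. -/
theorem value_exit (E : ℕ → ℝ≥0) (P : Tile (ℕ × ℕ) → ℝ≥0) {x : ℕ × ℕ}
    (hex : exit (b x.1) x.2 ≠ 0) :
    value b m E P x = cols (b x.1) + E (next b m x) := by
  rw [next, if_neg hex]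
  cases h : b x.1 with
  | false => simp [value, h, cols, exit, glue]
  | true =>
    rw [h] at hex
    simp only [value, h, cols, exit, cond_true] at hex ⊢
    split_ifs at hex ⊢ with h1 h2
    · simp [h1, exitThree, exitTwo, glue]
    · rcases h2 with h2 | h2 <;> simp [h2, exitThree, exitTwo, glue]
    · exact absurd rfl hex

theorem cols_le_value (E : ℕ → ℝ≥0) (P : Tile (ℕ × ℕ) → ℝ≥0) (x : ℕ × ℕ) :
    (cols (b x.1) : ℝ≥0) ≤ value b m E P x := by
  cases h : b x.1 with
  | false => simp [value, h, cols]
  | true => simp [value, h, cols, add_assoc]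

theorem value_le (E : ℕ → ℝ≥0) (P : Tile (ℕ × ℕ) → ℝ≥0) {x : ℕ × ℕ} (hx : x.1 ≤ m + 1) :
    value b m E P x ≤ 5 + E m + ∑ i ∈ Finset.range (m + 1), E i := by
  have h1 : E (x.1 - 1) ≤ ∑ i ∈ Finset.range (m + 1), E i :=
    Finset.single_le_sum (f := E) (fun _ _ => zero_le) (Finset.mem_range.2 (by omega))
  rw [value]
  cases b x.1 with
  | false =>
    refine add_le_add (le_trans ?_ le_self_add) h1
    norm_num
  | true =>
    refine add_le_add (add_le_add le_rfl ?_) (le_trans ?_ h1)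
    · exact mul_le_of_le_one_left zero_le (exit_le_one _ _ _).1
    · exact mul_le_of_le_one_left zero_le (exit_le_one _ _ _).2

theorem sum_localMoves (hP : ∀ t, 0 < P t) (E : ℕ → ℝ≥0) (o : ℕ) {x : ℕ × ℕ} (h0 : 0 < x.2)
    (hx : x.2 < states (b x.1)) :
    ((localMoves b m o x).map fun a => P a.1.2 * value b m E P a.2).sum =
      ((localMoves b m o x).map fun a => P a.1.2).sum * value b m E P x := by
  simp only [localMoves, List.map_map, Function.comp_def, value]
  cases h : b x.1 with
  | false =>
    simp only [cond_false]
    rw [List.sum_map_mul_right]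
  | true =>
    rw [h] at hx
    simp only [cond_true]
    exact sum_moves_exit (w := fun t => P (tile b m x.1 t)) (hP _) (E m) (E (x.1 - 1)) hx h0

theorem mean_cons (x : ℕ × ℕ) (l : List (ℕ × ℕ)) :
    mean b m E P (x :: l) = width b l + value b m E P x := rfl

theorem width_innerMoves {l : List (ℕ × ℕ)} {v : ((ℤ × ℤ) × Tile (ℕ × ℕ)) × List (ℕ × ℕ)}
    (hv : v ∈ innerMoves b m l) : width b v.2 = width b l := by
  obtain ⟨l₁, z, l₂, rfl, a, -, rfl⟩ := mem_innerMoves.1 hv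
  simp only [width_append, width]

/-- The three kinds of moves balance separately. Starting a block leaves `mean` unchanged because
the exit already fixes the successor; moves in the easternmost block are balanced by the fairness of
the coin; moves further west change neither the widths nor the easternmost block. -/
theorem sum_allMoves (hP : ∀ t, 0 < P t) (hE : IsExpectation b m E) {l : List (ℕ × ℕ)}
    (hl : Valid b m l) : ((allMoves b m l).map fun a => P a.1.2 * mean b m E P a.2).sum =
      ((allMoves b m l).map fun a => P a.1.2).sum * mean b m E P l := by
  obtain ⟨x, l, rfl⟩ := List.exists_cons_of_ne_nil hl.ne_nil
  have hx := hl.block x (by simp)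
  rw [allMoves, List.map_append, List.map_append, List.sum_append, List.sum_append, innerMoves,
    List.map_append, List.map_append, List.sum_append, List.sum_append, add_mul, add_mul]
  congr 1
  · rw [outerMoves]
    split_ifs with h0
    · simp
    · have hex : exit (b x.1) x.2 ≠ 0 := fun hex => h0 (by rw [next, if_pos hex])
      have h1 := (hl.new h0).block _ (List.mem_cons_self ..)
      simp only [List.map_cons, List.map_nil, List.sum_singleton, mean_cons, width]
      rw [value_first hE h1.1 h1.2.1, value_exit E P hex]
      push_cast
      ring
  congr 1
  · have h1 := sum_localMoves (m := m) hP E (width b l) hx.2.2.1 hx.2.2.2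
    simp only [List.map_map, Function.comp_def, mean_cons, mul_add, List.sum_map_add,
      List.sum_map_mul_right, h1]
  · rw [← List.sum_map_mul_right]
    simp only [List.map_map, Function.comp_def]
    congr 1
    refine List.map_congr_left fun a ha => ?_
    rw [mean_cons, mean_cons, width_innerMoves ha]

theorem size_le_width {l : List (ℕ × ℕ)} (hl : ∀ x ∈ l, 0 < x.2 ∧ x.2 < states (b x.1)) :
    size b l ≤ 4 * width b l ∧ width b l ≤ 5 * size b l := by
  induction l with
  | nil => simp [size, width]
  | cons x l ih =>
    have h1 := ih fun y hy => hl y (by simp [hy])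
    have h2 := hl x (by simp)
    have h3 := state_spec _ _ h2.2 h2.1
    have h4 : cols (b x.1) ≤ 5 := by cases b x.1 <;> decide
    simp only [size, List.map_cons, List.sum_cons, width] at h1 ⊢
    omega

theorem size_allMoves {l : List (ℕ × ℕ)} (hl : Valid b m l) :
    ∀ v ∈ allMoves b m l, size b v.2 = size b l + 1 := by
  intro v hv
  rcases List.mem_append.1 hv with hv | hv
  · obtain ⟨z, l, rfl⟩ := List.exists_cons_of_ne_nil hl.ne_nil
    obtain ⟨h0, rfl⟩ := mem_outerMoves.1 hv
    have h1 : ∀ k, Block.size k 1 = 1 := by decide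
    simp only [size, List.map_cons, List.sum_cons, h1]
    omega
  · obtain ⟨l₁, z, l₂, rfl, a, ha, rfl⟩ := mem_innerMoves.1 hv
    have hz := hl.block z (by simp)
    have h1 := (update_spec _ _ hz.2.2.2 hz.2.2.1 a ha).1
    simp only [size, List.map_append, List.map_cons, List.sum_append, List.sum_cons,
      h1.2.2.2.2.2.2.1]
    omega

/-- The factor 4 is the number of rows: `mean` is at least the current width. Conversely the width
is at most five times the number of tiles, and the value of the last block is bounded by a constant.
-/
theorem controlled (hP : ∀ t, 0 < P t) (hE : IsExpectation b m E) :
    Controlled (TileSystem.weighted (Γ := system b m) P (allMoves b m))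
      (fun l => Valid b m l ∧ (asm b m l).Stable str 2) (mean b m E P) (size b)
      (10 + E m + ∑ i ∈ Finset.range (m + 1), E i) where
  inv := (simulation b m).inv_weighted P
  weight l v hv := by
    obtain ⟨a, -, rfl⟩ := List.mem_map.1 hv
    exact ⟨ENNReal.coe_ne_zero.2 (hP _).ne', ENNReal.coe_ne_top⟩
  harmonic l hl := by
    have h1 := congrArg (fun r : ℝ≥0 => (r : ℝ≥0∞)) (sum_allMoves hP hE hl.1)
    have h2 : ∀ L : List ℝ≥0, ((L.sum : ℝ≥0) : ℝ≥0∞) = (L.map fun r : ℝ≥0 => (r : ℝ≥0∞)).sum :=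
      fun L => map_list_sum ENNReal.ofNNRealHom L
    simp only [ENNReal.coe_mul, h2, List.map_map] at h1
    change (((allMoves b m l).map fun a => ((P a.1.2 : ℝ≥0∞), a.2)).map fun v =>
      v.1 * (mean b m E P v.2 : ℝ≥0∞)).sum = (((allMoves b m l).map fun a =>
        ((P a.1.2 : ℝ≥0∞), a.2)).map fun v => v.1).sum * (mean b m E P l : ℝ≥0∞)
    rw [List.map_map, List.map_map]
    refine Eq.trans ?_ h1
    congr 1
  size_succ l hl v hv := by
    obtain ⟨a, ha, rfl⟩ := List.mem_map.1 hv
    exact size_allMoves hl.1 a ha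
  size_le l hl := by
    obtain ⟨x, l, rfl⟩ := List.exists_cons_of_ne_nil hl.1.ne_nil
    have h1 := (size_le_width fun y hy => (hl.1.block y hy).2.2).1
    calc (size b (x :: l) : ℝ≥0) ≤ (4 * width b (x :: l) : ℕ) := by exact_mod_cast h1
      _ = 4 * (width b l + cols (b x.1)) := by rw [width]; push_cast; ring
      _ ≤ _ := by
        rw [mean_cons]
        gcongr
        exact cols_le_value E P x
  le_size l hl := by
    obtain ⟨x, l, rfl⟩ := List.exists_cons_of_ne_nil hl.1.ne_nil
    have h1 := (size_le_width fun y hy => (hl.1.block y hy).2.2).2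
    have h2 : (width b l : ℝ≥0) ≤ 5 * size b (x :: l) := by
      rw [width] at h1
      exact_mod_cast (Nat.le_add_left _ _).trans h1
    have h3 := value_le (b := b) E P (hl.1.block x (by simp)).2.1
    rw [mean_cons]
    refine (add_le_add h2 h3).trans ?_
    set r := ∑ i ∈ Finset.range (m + 1), E i
    set q := (size b (x :: l) : ℝ≥0)
    calc 5 * q + (5 + E m + r) ≤ 5 * q + (5 + E m + r) + (5 * q + 5 + E m * q + r * q) :=
        le_self_add
      _ = _ := by ring

/-- The properties of the system of blocks. -/
theorem system_spec (hE : IsExpectation b m E) :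
    (system b m).IsFinite ∧ (∀ A, (system b m).Terminal A → ∃ l : ℕ, A.IsLine 4 l) ∧
      ∀ P : Tile (ℕ × ℕ) → ℝ≥0, (system b m).IsConcentration P →
        (system b m).totalProb P = 1 ∧ (system b m).expectedLength P = E (m + 1) := by
  have M := simulation b m
  -- Reachability of a terminal assembly does not involve concentrations, so any positive weights
  -- serve.
  refine ⟨M.isFinite (controlled (P := fun _ => 1) (fun _ => one_pos) hE), ?_, ?_⟩
  · rintro A ⟨hA, hstuck⟩
    obtain ⟨l, hl, rfl⟩ := M.producible_iff hA
    have h1 := (M.stuck_iff hl).1 hstuck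
    obtain ⟨x, l, rfl⟩ := List.exists_cons_of_ne_nil hl.1.ne_nil
    refine ⟨width b (x :: l), 0, 0, ?_⟩
    refine (complete_of_allMoves_eq_nil hl.1 h1).2.2.trans ?_
    simp
  · intro P hP
    set Q : Tile (ℕ × ℕ) → ℝ≥0 := fun t => if t ∈ (system b m).tiles then P t else 1 with hQ
    have hPQ : ∀ t ∈ (system b m).tiles, P t = Q t := fun t ht => (if_pos ht).symm
    have hpos : ∀ t, 0 < Q t := by
      intro t
      rw [hQ]
      dsimp only
      split_ifs with ht
      · exact hP.1 t ht
      · exact one_pos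
    have D := controlled hpos hE
    rw [TileSystem.totalProb_congr hPQ, TileSystem.expectedLength_congr hPQ]
    refine ⟨M.totalProb_eq_one D, ?_⟩
    rw [M.expectedLength_eq D, mean_cons, value_first hE (Nat.succ_pos m) le_rfl]
    · simp [width]
    · intro l hl h1
      obtain ⟨x, l, rfl⟩ := List.exists_cons_of_ne_nil hl.1.ne_nil
      have h2 := complete_of_allMoves_eq_nil hl.1 h1
      refine (congrArg Nat.cast (length_of_dom h2.2.2)).trans ?_
      -- In a complete line the last exit leads to state 0, and `E 0 = 0`, so `mean` is the actual
      -- width.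
      rw [mean_cons, value_exit E _ h2.2.1, h2.1, hE.zero, width]
      push_cast
      ring

end Line

/-! ### Realising a prescribed expectation by logarithmically many blocks -/

namespace Line

/-- A sequence of column blocks and coin blocks along which `G` decreases from `g` to `0`. -/
theorem exists_gaps (g : ℕ) : ∃ (m : ℕ) (G : ℕ → ℕ) (b : ℕ → Bool), G 0 = g ∧ G m = 0 ∧
    m ≤ 2 * Nat.log 2 (g + 1) + 9 ∧
    ∀ i < m, G i = bif b (i + 1) then 2 * G (i + 1) + 10 else G (i + 1) + 1 := by
  have prepend : ∀ (k : Bool) (g g' m : ℕ) (G : ℕ → ℕ) (b : ℕ → Bool), G 0 = g' →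
      (∀ i < m, G i = bif b (i + 1) then 2 * G (i + 1) + 10 else G (i + 1) + 1) →
      (g = bif k then 2 * g' + 10 else g' + 1) →
      ∃ (G' : ℕ → ℕ) (b' : ℕ → Bool), G' 0 = g ∧ G' (m + 1) = G m ∧
        ∀ i < m + 1, G' i = bif b' (i + 1) then 2 * G' (i + 1) + 10 else G' (i + 1) + 1 := by
    intro k g g' m G b h0 h1 h2
    refine ⟨fun i => if i = 0 then g else G (i - 1), fun i => if i = 1 then k else b (i - 1),
      rfl, by simp, fun i hi => ?_⟩
    rcases i with _ | i
    · simpa [h0] using h2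
    · simpa using h1 i (by omega)
  induction g using Nat.strong_induction_on with
  | _ g ih =>
    rcases Nat.eq_zero_or_pos g with rfl | hg
    · exact ⟨0, fun _ => 0, fun _ => false, rfl, rfl, Nat.zero_le _, by simp⟩
    by_cases h10 : g < 10
    · have small : ∀ g, g < 10 → ∃ (m : ℕ) (G : ℕ → ℕ) (b : ℕ → Bool), G 0 = g ∧ G m = 0 ∧
          m = g ∧ ∀ i < m, G i = bif b (i + 1) then 2 * G (i + 1) + 10 else G (i + 1) + 1 :=
        fun g _ => ⟨g, fun i => g - i, fun _ => false, rfl, Nat.sub_self g, rfl, fun i hi => by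
          simp only [cond_false]; omega⟩
      obtain ⟨m, G, b, h1, h2, rfl, h3⟩ := small g h10
      exact ⟨m, G, b, h1, h2, by omega, h3⟩
    -- Each halving costs at most two blocks, a coin and for odd `g` a column before it; gaps below
    -- 10 take at most nine columns.
    · have hlog : ∀ g', 2 * (g' + 1) ≤ g + 1 → Nat.log 2 (g' + 1) + 1 ≤ Nat.log 2 (g + 1) := by
        intro g' hg'
        rw [← Nat.log_mul_base one_lt_two (Nat.succ_ne_zero g')]
        exact Nat.log_mono_right (by omega)
      rcases Nat.even_or_odd' g with ⟨r, rfl | rfl⟩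
      · obtain ⟨m, G, b, h1, h2, h3, h4⟩ := ih (r - 5) (by omega)
        obtain ⟨G', b', h5, h6, h7⟩ := prepend true (2 * r) _ m G b h1 h4 (by
          simp only [cond_true]; omega)
        have := hlog (r - 5) (by omega)
        exact ⟨m + 1, G', b', h5, h6.trans h2, by omega, h7⟩
      · obtain ⟨m, G, b, h1, h2, h3, h4⟩ := ih (r - 5) (by omega)
        obtain ⟨G', b', h5, h6, h7⟩ := prepend true (2 * r) _ m G b h1 h4 (by
          simp only [cond_true]; omega)
        obtain ⟨G', b', h5, h8, h7⟩ := prepend false (2 * r + 1) _ _ G' b' h5 h7 rfl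
        have := hlog (r - 5) (by omega)
        exact ⟨m + 1 + 1, G', b', h5, h8.trans (h6.trans h2), by omega, h7⟩

/-- A sequence of logarithmically many blocks with a prescribed expectation. -/
theorem exists_isExpectation (n : ℕ) : ∃ (m : ℕ) (b : ℕ → Bool) (E : ℕ → ℝ≥0),
    m ≤ 2 * Nat.log 2 (n + 1) + 9 ∧ IsExpectation b m E ∧ E (m + 1) = n + 1 := by
  obtain ⟨m, G, b, h0, h1, h2, h3⟩ := exists_gaps n
  have hG : ∀ i ≤ m, G i ≤ n := by
    intro i hi
    induction i with
    | zero => exact h0.le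
    | succ i ih =>
      have h4 := ih (by omega)
      rw [h3 i (by omega)] at h4
      cases hb : b (i + 1) <;> rw [hb] at h4 <;> simp only [cond_true, cond_false] at h4 <;> omega
  -- `E i = n - G i` on the states up to `m`, hence `E m = n`. The start state `m + 1` is an extra
  -- column, which adds one; it keeps the start distinct from the state `m` to which coins return.
  refine ⟨m, fun i => if i = m + 1 then false else b i,
    fun i => if i = m + 1 then n + 1 else ((n - G i : ℕ) : ℝ≥0), h2, ⟨?_, ?_, ?_⟩, if_pos rfl⟩
  · simp [h0]
  · intro i hi hb
    rw [if_neg (by omega : i ≠ m + 1)]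
    by_cases him : i = m
    · rw [him, if_pos rfl, h1, Nat.sub_zero, add_comm]
    · rw [if_neg (by omega)] at hb ⊢
      have h4 := h3 i (by omega)
      rw [hb, cond_false] at h4
      have h5 := hG i hi
      have h6 : n - G (i + 1) = 1 + (n - G i) := by omega
      rw [h6]
      push_cast
      rfl
  · intro i hi hb
    by_cases him : i = m
    · simp [him] at hb
    · rw [if_neg (by omega)] at hb
      rw [if_neg (by omega), if_neg (by omega), if_neg (by omega), h1, Nat.sub_zero]
      have h4 := h3 i (by omega)
      rw [hb, cond_true] at h4
      have h5 := hG i hi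
      -- This is twice the coin recursion, with `n = E m`; the bound `G i ≤ n` makes the truncated
      -- subtractions exact.
      have h6 : ((2 * (n - G (i + 1)) : ℕ) : ℝ≥0) = (10 + n + (n - G i) : ℕ) := by
        congr 1
        omega
      rw [Nat.cast_mul, Nat.cast_add, Nat.cast_add] at h6
      push_cast [-Nat.cast_tsub] at h6
      rw [← mul_right_inj' (two_ne_zero (α := ℝ≥0)), h6]
      field_simp
      ring

end Line

end ATAM
end

theorem mainTheorem4 :
    ∃ Γ : ℕ → ATAM.TileSystem,
      (fun n : ℕ => ((Γ n).tiles.card : ℝ)) =O[atTop] (fun n : ℕ => Real.log (n : ℝ)) ∧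
      ∀ n : ℕ, 0 < n →
        (Γ n).temp = 2 ∧
        (Γ n).seed.dom.ncard = 1 ∧
        (Γ n).IsFinite ∧
        (∀ A, (Γ n).Terminal A → ∃ l : ℕ, A.IsLine 4 l) ∧
        ∀ P : ATAM.Tile (Γ n).Glue → NNReal, (Γ n).IsConcentration P →
          (Γ n).totalProb P = 1 ∧ (Γ n).expectedLength P = (n : ENNReal) := by
  choose m b E hm hE hn using ATAM.Line.exists_isExpectation
  -- The shift by one undoes the extra column of the start state.
  refine ⟨fun n => ATAM.Line.system (b (n - 1)) (m (n - 1)), ?_, fun n h0 => ⟨rfl, ?_, ?_⟩⟩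
  · refine IsBigO.of_bound (240 / Real.log 2) ?_
    filter_upwards [eventually_ge_atTop 2] with n h2
    have h3 : 0 < Nat.log 2 n := Nat.log_pos one_lt_two h2
    have h4 := ATAM.Line.card_tiles_le (b (n - 1)) (m (n - 1))
    have h5 := hm (n - 1)
    rw [Nat.sub_add_cancel (by omega : 1 ≤ n)] at h5
    -- With `L = Nat.log 2 n ≥ 1` the count is at most `20 * (2 * L + 10) ≤ 240 * L`.
    have h6 : (ATAM.Line.system (b (n - 1)) (m (n - 1))).tiles.card ≤ 240 * Nat.log 2 n := by
      omega
    have h7 := Real.natLog_le_logb n 2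
    have h8 : 0 ≤ Real.log n := Real.log_natCast_nonneg n
    rw [Real.norm_of_nonneg (Nat.cast_nonneg _), Real.norm_of_nonneg h8]
    calc _ ≤ ((240 * Nat.log 2 n : ℕ) : ℝ) := by exact_mod_cast h6
      _ = 240 * (Nat.log 2 n : ℝ) := by push_cast; rfl
      _ ≤ 240 * Real.logb (2 : ℕ) n := by gcongr
      _ = _ := by rw [Real.logb]; push_cast; ring
  · exact (congrArg Set.ncard (ATAM.Line.seed_dom _)).trans (Set.ncard_singleton _)
  · have h1 := ATAM.Line.system_spec (hE (n - 1))
    refine ⟨h1.1, h1.2.1, fun P hP => ⟨(h1.2.2 P hP).1, (h1.2.2 P hP).2.trans ?_⟩⟩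
    rw [hn, ← Nat.cast_succ, ENNReal.coe_natCast, Nat.succ_eq_add_one,
      Nat.sub_add_cancel (by omega)]
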